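/- Setting. Let $x_{k+1}=A_{\mathrm{tr}}x_k+B_{\mathrm{tr}}u_k+w_k$, $x_0=0$, with $x_k,w_k\in\mathbb R^{n_x}$, $u_k\in\mathbb R^{n_u}$, $A_{\mathrm{tr}}$ Schur stable, $(A_{\mathrm{tr}},B_{\mathrm{tr}})$ controllable, and let $C\ge 1$, $\rho\in(0,1)$ satisfy $\|A_{\mathrm{tr}}^k\|\le C\rho^k$ for all $k\in\mathbb N$. Put $\phi_k=(x_k,u_k)\in\mathbb R^{n_\phi}$, $n_\phi=n_x+n_u$, $n_\theta=n_xn_\phi$, $\theta_{\mathrm{tr}}=\mathrm{vec}[A_{\mathrm{tr}},B_{\mathrm{tr}}]$. There is a filtration $(\mathcal F_k)_{k\ge -1}$ such that $w_k$ is $\mathcal F_k$-measurable, has mean zero, and is conditionally sub-Gaussian with proxy variance $\sigma_w^2I$: $\mathbb E[\exp(v^\top w_k)\mid\mathcal F_{k-1}]\le\exp(\sigma_w^2\|v\|^2/2)$ for all $v\in\mathbb R^{n_x}$. Further, $(\hat\theta_0-\theta_{\mathrm{tr}})^\top(D_0\otimes I_{n_x})(\hat\theta_0-\theta_{\mathrm{tr}})\le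 1$ for a known $\hat\theta_0$ and a known $D_0\succ0$; put $\bar\theta=\|\hat\theta_0\|+\|D_0^{-1/2}\|$. Input. Fix $T\ge1$ and distinct frequencies $\omega_1,\dots,\omega_L\in\{0,1/T,\dots,(T-1)/T\}$, and apply $u_k=\sum_{i=1}^L\bar u(\omega_i)\cos(2\pi\omega_ik)$ with $\bar u(\omega_i)\in\mathbb R^{n_u}$, where $\bar u(\omega_i)=\bar u(\omega_j)$ whenever $\omega_i+\omega_j=1$, and $\sum_{i=1}^L\|\bar u(\omega_i)\|^2\le\gamma_e^2$, $\gamma_e\ge 0$. Put $U_e=\mathrm{diag}(\bar u(\omega_1),\dots,\bar u(\omega_L))\in\mathbb R^{Ln_u\times L}$, $V_i=\begin{bmatrix}(e^{j2\pi\omega_i}I-A_{\mathrm{tr}})^{-1}B_{\mathrm{tr}}\\ I_{n_u}\end{bmatrix}$, $V_{\mathrm{tr}}=[V_1,\dots,V_L]$. Estimate. Let $\lambda>0$, $\Phi=[\phi_0,\dots,\phi_{T-1}]$, $X=(x_1,\dots,x_T)$ stacked, $\bar D_T=(\Phi\Phi^\top)\otimes I_{n_x}+\lambda I_{n_\theta}$,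 and $\hat\theta_T=\bar D_T^{-1}(\Phi\otimes I_{n_x})X$. Constants. Let $\delta,\epsilon\in(0,1)$, $D_{\mathrm{des}}\succ0$; let $A_w$ be the block lower triangular $Tn_x\times Tn_x$ matrix with blocks $A_{\mathrm{tr}}^{k-l}$, $0\le l\le k<T$; and put $$\gamma_w=\sigma_w^2\big((1+\log 4)Tn_x+4\log\delta^{-1}\big),\qquad \Gamma_w=\tfrac LT\|A_w\|^2\gamma_w I_{n_\phi},\qquad \Gamma_u=\tfrac{4L\gamma_e^2}{T}\Big(\tfrac{\|B_{\mathrm{tr}}\|C}{(1-\rho)^2}\Big)^2I_{n_\phi},$$ $$C_1=4\sigma_w^2\big(\log(5^{2n_x}/\delta^2)-n_\theta\log\lambda\big).$$ Matrix norms are largest singular values. Claim. Let $\tilde U\in\mathbb R^{Ln_u\times L}$ be any fixed matrix, and consider the matrix inequality (which depends on the realized data through $\bar D_T$) $$(1-\epsilon)V_{\mathrm{tr}}\big(U_e\tilde U^\top+\tilde UU_e^\top-\tilde U\tilde U^\top\big)V_{\mathrm{tr}}^{\mathsf H}-\tfrac{2(1-\epsilon)}{\epsilon}\Gamma_u+\tfrac\lambda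 TI_{n_\phi}-\tfrac{2(1-\epsilon)}{\epsilon}\Gamma_w-\tfrac1T\big(2C_1+8\sigma_w^2\log\det\bar D_T+2\lambda\bar\theta^2\big)D_{\mathrm{des}}\succeq0. \quad (*)$$ Then, with probability at least $1-2\delta$, if $(*)$ holds for the realized data, the exploration goal $$(\theta_{\mathrm{tr}}-\hat\theta_T)^\top(D_{\mathrm{des}}\otimes I_{n_x})(\theta_{\mathrm{tr}}-\hat\theta_T)\le1$$ holds. In particular, if $(*)$ holds almost surely, then the exploration goal holds with probability at least $1-2\delta$. -/

import Mathlib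

open MeasureTheory
open scoped Matrix Kronecker ComplexOrder

noncomputable section

namespace TargetedExploration

/-! ### Norms -/

/-- The largest singular value of a real matrix (operator norm for the Euclidean norms). -/
def specNorm {m n : Type*} [Fintype m] [Fintype n] [DecidableEq n] (M : Matrix m n ℝ) : ℝ :=
  letI := Matrix.instL2OpNormedAddCommGroup (m := m) (n := n) (𝕜 := ℝ)
  ‖M‖

/-- The Euclidean norm of a real vector. -/
def euclNorm {ι : Type*} [Fintype ι] (v : ι → ℝ) : ℝ :=
  Real.sqrt (v ⬝ᵥ v)

/-! ### Disturbance -/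

/-- The random vector `X` with mean `ν` is sub-Gaussian with proxy variance `S`, conditionally
on the σ-algebra `m'`. Integrability is required because the conditional expectation of a
non-integrable function has a junk value. -/
def IsCondSubGaussian {Ω ι : Type*} [Fintype ι] {mΩ : MeasurableSpace Ω} (P : Measure Ω)
    (m' : MeasurableSpace Ω) (X : Ω → ι → ℝ) (ν : ι → ℝ) (S : Matrix ι ι ℝ) : Prop :=
  (∀ i, Integrable (fun s => X s i) P ∧ ∫ s, X s i ∂P = ν i) ∧
  ∀ v : ι → ℝ,
    Integrable (fun s => Real.exp (v ⬝ᵥ (X s - ν))) P ∧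
    P[fun s => Real.exp (v ⬝ᵥ (X s - ν)) | m'] ≤ᵐ[P]
      fun _ => Real.exp ((v ⬝ᵥ (S *ᵥ v)) / 2)

/-! ### System -/

section System

variable {nx nu : ℕ}

/-- All eigenvalues lie in the open complex unit disc. -/
def SchurStable (A : Matrix (Fin nx) (Fin nx) ℝ) : Prop :=
  ∀ z ∈ spectrum ℂ (A.map ((↑) : ℝ → ℂ)), ‖z‖ < 1

/-- `[B, AB, …, A^(nx-1) B]` has full row rank. -/
def Controllable (A : Matrix (Fin nx) (Fin nx) ℝ) (B : Matrix (Fin nx) (Fin nu) ℝ) : Prop :=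
  (Matrix.of fun (i : Fin nx) (p : Fin nx × Fin nu) => (A ^ (p.1 : ℕ) * B) i p.2).rank = nx

/-- The parameter vector `vec [A, B]` (columns stacked; index: (column, row)). -/
def param (A : Matrix (Fin nx) (Fin nx) ℝ) (B : Matrix (Fin nx) (Fin nu) ℝ) :
    (Fin nx ⊕ Fin nu) × Fin nx → ℝ :=
  Matrix.vec (Matrix.fromCols A B)

/-- The state of `x (k+1) = A x k + B u k + w k`, `x 0 = 0`. -/
def state (A : Matrix (Fin nx) (Fin nx) ℝ) (B : Matrix (Fin nx) (Fin nu) ℝ)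
    (u : ℕ → Fin nu → ℝ) (w : ℕ → Fin nx → ℝ) : ℕ → Fin nx → ℝ
  | 0 => 0
  | k + 1 => A *ᵥ state A B u w k + B *ᵥ u k + w k

/-- `Φ = [φ_0, …, φ_(T-1)]` with `φ_k = (x_k, u_k)`. -/
def regressor (T : ℕ) (x : ℕ → Fin nx → ℝ) (u : ℕ → Fin nu → ℝ) :
    Matrix (Fin nx ⊕ Fin nu) (Fin T) ℝ :=
  Matrix.of fun a k => Sum.elim (x k) (u k) a

/-- `X = (x_1, …, x_T)`, stacked. -/
def stackedState (T : ℕ) (x : ℕ → Fin nx → ℝ) : Fin T × Fin nx → ℝ :=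
  fun p => x (p.1 + 1) p.2

/-- `(Φ Φᵀ) ⊗ I + lam I`. -/
def Dbar {T : ℕ} (lam : ℝ) (Phi : Matrix (Fin nx ⊕ Fin nu) (Fin T) ℝ) :
    Matrix ((Fin nx ⊕ Fin nu) × Fin nx) ((Fin nx ⊕ Fin nu) × Fin nx) ℝ :=
  (Phi * Phiᵀ) ⊗ₖ (1 : Matrix (Fin nx) (Fin nx) ℝ) + lam • 1

/-- The regularized least squares estimate. -/
def estimate {T : ℕ} (lam : ℝ) (Phi : Matrix (Fin nx ⊕ Fin nu) (Fin T) ℝ)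
    (X : Fin T × Fin nx → ℝ) : (Fin nx ⊕ Fin nu) × Fin nx → ℝ :=
  (Dbar lam Phi)⁻¹ *ᵥ ((Phi ⊗ₖ (1 : Matrix (Fin nx) (Fin nx) ℝ)) *ᵥ X)

/-- `(θ - θ')ᵀ (D ⊗ I) (θ - θ') ≤ 1`. Used both for the prior set and for the goal. -/
def InEllipsoid (D : Matrix (Fin nx ⊕ Fin nu) (Fin nx ⊕ Fin nu) ℝ)
    (θ θ' : (Fin nx ⊕ Fin nu) × Fin nx → ℝ) : Prop :=
  (θ - θ') ⬝ᵥ ((D ⊗ₖ (1 : Matrix (Fin nx) (Fin nx) ℝ)) *ᵥ (θ - θ')) ≤ 1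

end System

/-! ### Exploration input -/

/-- `Ω_T = {0, 1/T, …, (T-1)/T}`. -/
def freqGrid (T : ℕ) : Set ℝ := {f | ∃ m : ℕ, m < T ∧ f = (m : ℝ) / T}

/-- `u_k = ∑ i, cos (2 π ω_i k) ū_i`. -/
def exploreInput {L nu : ℕ} (freq : Fin L → ℝ) (ubar : Fin L → Fin nu → ℝ) :
    ℕ → Fin nu → ℝ :=
  fun k => ∑ i, Real.cos (2 * Real.pi * freq i * k) • ubar i

/-- `U_e = diag (ū_1, …, ū_L)`, of size `L nu × L`. -/
def Ue {L nu : ℕ} (ubar : Fin L → Fin nu → ℝ) : Matrix (Fin L × Fin nu) (Fin L) ℝ :=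
  Matrix.of fun p j => if p.1 = j then ubar p.1 p.2 else 0

/-! ### Quantities in the matrix inequality -/

section LMI

variable {nx nu L T : ℕ}

/-- `V(ω) = [(e^(2πjω) I - A)⁻¹ B ; I]`. -/
def transferMat (A : Matrix (Fin nx) (Fin nx) ℝ) (B : Matrix (Fin nx) (Fin nu) ℝ) (f : ℝ) :
    Matrix (Fin nx ⊕ Fin nu) (Fin nu) ℂ :=
  Matrix.fromRows
    ((Complex.exp (2 * Real.pi * Complex.I * f) • (1 : Matrix (Fin nx) (Fin nx) ℂ)
        - A.map ((↑) : ℝ → ℂ))⁻¹ * B.map ((↑) : ℝ → ℂ))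
    1

/-- `V_tr = [V(ω_1), …, V(ω_L)]`. -/
def Vtr (A : Matrix (Fin nx) (Fin nx) ℝ) (B : Matrix (Fin nx) (Fin nu) ℝ) (freq : Fin L → ℝ) :
    Matrix (Fin nx ⊕ Fin nu) (Fin L × Fin nu) ℂ :=
  Matrix.of fun a p => transferMat A B (freq p.1) a p.2

/-- The block lower triangular Toeplitz matrix with blocks `A^(k-l)`, `l ≤ k < T`. -/
def Aw (T : ℕ) (A : Matrix (Fin nx) (Fin nx) ℝ) :
    Matrix (Fin T × Fin nx) (Fin T × Fin nx) ℝ :=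
  Matrix.of fun p q =>
    if (q.1 : ℕ) ≤ (p.1 : ℕ) then (A ^ ((p.1 : ℕ) - (q.1 : ℕ))) p.2 q.2 else 0

/-- `γ_w = σ² ((1 + log 4) T nx + 4 log (1/δ))`. -/
def gammaW (nx T : ℕ) (σ δ : ℝ) : ℝ :=
  σ ^ 2 * ((1 + Real.log 4) * T * nx + 4 * Real.log δ⁻¹)

/-- `Γ_w = (L/T) ‖A_w‖² γ_w I`. -/
def GammaW (nu L T : ℕ) (A : Matrix (Fin nx) (Fin nx) ℝ) (σ δ : ℝ) :
    Matrix (Fin nx ⊕ Fin nu) (Fin nx ⊕ Fin nu) ℝ :=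
  ((L : ℝ) / T * specNorm (Aw T A) ^ 2 * gammaW nx T σ δ) • 1

/-- `Γ_u(γ_e²) = (4 L γ_e² / T) (‖B‖ C / (1-ρ)²)² I`. -/
def GammaU (L T : ℕ) (B : Matrix (Fin nx) (Fin nu) ℝ) (C ρ γe : ℝ) :
    Matrix (Fin nx ⊕ Fin nu) (Fin nx ⊕ Fin nu) ℝ :=
  (4 * L * γe ^ 2 / T * (specNorm B * C / (1 - ρ) ^ 2) ^ 2) • 1

/-- `C₁ = 4 σ² (log (5^(2 nx) / δ²) - n_θ log lam)`, `n_θ = nx (nx + nu)`. -/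
def C1 (nx nu : ℕ) (σ δ lam : ℝ) : ℝ :=
  4 * σ ^ 2 * (Real.log (5 ^ (2 * nx) / δ ^ 2) - ((nx * (nx + nu) : ℕ) : ℝ) * Real.log lam)

open scoped MatrixOrder Matrix.Norms.L2Operator in
/-- `D^(-1/2)`, the positive semidefinite square root of the inverse. -/
def invSqrt (D : Matrix (Fin nx ⊕ Fin nu) (Fin nx ⊕ Fin nu) ℝ) :
    Matrix (Fin nx ⊕ Fin nu) (Fin nx ⊕ Fin nu) ℝ :=
  CFC.sqrt D⁻¹

/-- `θ̄ = ‖θ̂₀‖ + ‖D₀^(-1/2)‖`. -/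
def thetaBar (θhat0 : (Fin nx ⊕ Fin nu) × Fin nx → ℝ)
    (D0 : Matrix (Fin nx ⊕ Fin nu) (Fin nx ⊕ Fin nu) ℝ) : ℝ :=
  euclNorm θhat0 + specNorm (invSqrt D0)

/-- The left-hand side of the exploration matrix inequality. -/
def lmiMatrix (A : Matrix (Fin nx) (Fin nx) ℝ) (B : Matrix (Fin nx) (Fin nu) ℝ)
    (freq : Fin L → ℝ) (U Utilde : Matrix (Fin L × Fin nu) (Fin L) ℝ)
    (C ρ γe σ δ ε lam θbar : ℝ) (Ddes : Matrix (Fin nx ⊕ Fin nu) (Fin nx ⊕ Fin nu) ℝ)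
    (Phi : Matrix (Fin nx ⊕ Fin nu) (Fin T) ℝ) :
    Matrix (Fin nx ⊕ Fin nu) (Fin nx ⊕ Fin nu) ℂ :=
  (1 - ε : ℂ) • (Vtr A B freq *
      (U * Utildeᵀ + Utilde * Uᵀ - Utilde * Utildeᵀ).map ((↑) : ℝ → ℂ) * (Vtr A B freq)ᴴ)
    + (-(2 * (1 - ε) / ε) • GammaU L T B C ρ γe
        + (lam / T) • (1 : Matrix (Fin nx ⊕ Fin nu) (Fin nx ⊕ Fin nu) ℝ)
        - (2 * (1 - ε) / ε) • GammaW nu L T A σ δ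
        - (1 / (T : ℝ) * (2 * C1 nx nu σ δ lam
            + 8 * σ ^ 2 * Real.log (Dbar lam Phi).det
            + 2 * lam * θbar ^ 2)) • Ddes).map ((↑) : ℝ → ℂ)

end LMI

/-! ### Data generated by one realization `w` of the disturbance -/

section Experiment

variable {nx nu L : ℕ}

/-- The regressor matrix `Φ` produced by the exploration input. -/
def dataRegressor (A : Matrix (Fin nx) (Fin nx) ℝ) (B : Matrix (Fin nx) (Fin nu) ℝ) (T : ℕ)
    (freq : Fin L → ℝ) (ubar : Fin L → Fin nu → ℝ) (w : ℕ → Fin nx → ℝ) :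
    Matrix (Fin nx ⊕ Fin nu) (Fin T) ℝ :=
  regressor T (state A B (exploreInput freq ubar) w) (exploreInput freq ubar)

/-- The estimate `θ̂_T` computed from the data produced by the exploration input. -/
def dataEstimate (A : Matrix (Fin nx) (Fin nx) ℝ) (B : Matrix (Fin nx) (Fin nu) ℝ) (T : ℕ)
    (lam : ℝ) (freq : Fin L → ℝ) (ubar : Fin L → Fin nu → ℝ) (w : ℕ → Fin nx → ℝ) :
    (Fin nx ⊕ Fin nu) × Fin nx → ℝ :=
  estimate lam (dataRegressor A B T freq ubar w)
    (stackedState T (state A B (exploreInput freq ubar) w))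

/-- The exploration matrix inequality for the realized data. -/
def LMIHolds (A : Matrix (Fin nx) (Fin nx) ℝ) (B : Matrix (Fin nx) (Fin nu) ℝ) (T : ℕ)
    (freq : Fin L → ℝ) (ubar : Fin L → Fin nu → ℝ)
    (Utilde : Matrix (Fin L × Fin nu) (Fin L) ℝ) (C ρ γe σ δ ε lam θbar : ℝ)
    (Ddes : Matrix (Fin nx ⊕ Fin nu) (Fin nx ⊕ Fin nu) ℝ) (w : ℕ → Fin nx → ℝ) : Prop :=
  (lmiMatrix A B freq (Ue ubar) Utilde C ρ γe σ δ ε lam θbar Ddes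
    (dataRegressor A B T freq ubar w)).PosSemidef

/-- The exploration goal for the realized data. -/
def GoalHolds (A : Matrix (Fin nx) (Fin nx) ℝ) (B : Matrix (Fin nx) (Fin nu) ℝ) (T : ℕ)
    (lam : ℝ) (freq : Fin L → ℝ) (ubar : Fin L → Fin nu → ℝ)
    (Ddes : Matrix (Fin nx ⊕ Fin nu) (Fin nx ⊕ Fin nu) ℝ) (w : ℕ → Fin nx → ℝ) : Prop :=
  InEllipsoid Ddes (param A B) (dataEstimate A B T lam freq ubar w)

end Experiment

end TargetedExploration

end

open TargetedExploration

namespace TargetedExploration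

/-! ### Square roots and Gaussian integrals -/

section Gaussian

set_option linter.unusedSectionVars false

variable {ι : Type*} [Fintype ι] [DecidableEq ι]

/-! Write `G = ΦΦᵀ ⊗ I`, `D̄ = G + λI`, `S = (Φ ⊗ I)w` and `e = θ - θ̂`. The normal equations give
`D̄e = λθ - S`, and the parallelogram law turns this into `2eᵀGe + λ|e|² ≤ 2λ|θ|² + 4SᵀD̄⁻¹S`
(`quadratic_error_le`, doubled). Let `κ` be the scalar in front of `D_des / T` in the matrix
inequality. If `κ` dominates this right-hand side and `κ(D_des ⊗ I) ⪯ 2G + λI`, then `κ eᵀ(D_des ⊗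
I)e ≤ κ`, which is the goal when `κ > 0`; when `κ = 0` the error vanishes.

Probability enters through two events, each failing with probability at most `δ`: a bound on
`SᵀD̄⁻¹S` and a bound `3γ_w/4` on the noise energy. Both are instances of the mixture bound
`measure_selfNormalized_gt_le`: the exponential supermartingale of `lintegral_exp_sum_le_one` is
integrated over its direction against a Gaussian, and Markov's inequality is applied to the result.

The rest is deterministic. The regressor is a steady-state sinusoid plus the noise response minus
the transient `Aᵏx_ss(0)`. Orthogonality of the sinusoids over one period gives the steady part
energy at least `T/2 · Σ|zᵀV_iū_i|²` (`sum_sq_steady_ge`); the two perturbations are removed by a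
weighted Young inequality (`gram_ge`). The matrix inequality, after a convexity step in `U_e`
(`lmi_quadratic`), then yields `κ D_des ⪯ 2ΦΦᵀ + λI`. The factor 2 compensates for `T/2`, which
comes from taking real parts; the constants in `κ` are large enough to pay for it. -/

open scoped MatrixOrder Matrix.Norms.L2Operator in
theorem sqrt_spec {Q : Matrix ι ι ℝ} (hQ : Q.PosDef) :
    (CFC.sqrt Q)ᵀ = CFC.sqrt Q ∧ CFC.sqrt Q * CFC.sqrt Q = Q ∧ (CFC.sqrt Q).det ≠ 0 := by
  have h1 : CFC.sqrt Q * CFC.sqrt Q = Q :=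
    CFC.sqrt_mul_sqrt_self Q (Matrix.nonneg_iff_posSemidef.2 hQ.posSemidef)
  have h2 : (CFC.sqrt Q)ᴴ = CFC.sqrt Q := (CFC.sqrt_nonneg Q).isSelfAdjoint
  refine ⟨by simpa using h2, h1, fun h => hQ.det_pos.ne' ?_⟩
  rw [← h1, Matrix.det_mul, h, zero_mul]

theorem exists_symm_sqrt {Q : Matrix ι ι ℝ} (hQ : Q.PosDef) :
    ∃ R : Matrix ι ι ℝ, Rᵀ = R ∧ R * R = Q ∧ R.det ≠ 0 :=
  ⟨_, sqrt_spec hQ⟩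

theorem dotProduct_mulVec_comm_of_symm {M : Matrix ι ι ℝ} (hM : Mᵀ = M) (x y : ι → ℝ) :
    x ⬝ᵥ (M *ᵥ y) = y ⬝ᵥ (M *ᵥ x) := by
  rw [Matrix.dotProduct_mulVec, ← Matrix.mulVec_transpose, hM, dotProduct_comm]

theorem dotProduct_self_nonneg' {ι : Type*} [Fintype ι] (v : ι → ℝ) : 0 ≤ v ⬝ᵥ v :=
  Finset.sum_nonneg fun i _ => mul_self_nonneg (v i)

/-- The mass of the unnormalized standard Gaussian. -/
noncomputable def gaussMass (ι : Type*) [Fintype ι] : ENNReal :=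
  ∫⁻ v : ι → ℝ, ENNReal.ofReal (Real.exp (-(v ⬝ᵥ v) / 2))

theorem measurable_gaussDensity :
    Measurable fun v : ι → ℝ => ENNReal.ofReal (Real.exp (-(v ⬝ᵥ v) / 2)) := by
  unfold dotProduct
  fun_prop

theorem gaussMass_ne_zero : gaussMass ι ≠ 0 := by
  unfold gaussMass
  rw [Ne, lintegral_eq_zero_iff measurable_gaussDensity]
  intro h
  have : ∀ᵐ _ : ι → ℝ, False := by
    filter_upwards [h] with v hv
    have : 0 < Real.exp (-(v ⬝ᵥ v) / 2) := Real.exp_pos _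
    simp only [Pi.zero_apply, ENNReal.ofReal_eq_zero] at hv
    linarith
  rw [Filter.eventually_false_iff_eq_bot, ae_eq_bot] at this
  exact NeZero.ne _ this

theorem gaussMass_ne_top : gaussMass ι ≠ ⊤ := by
  have h : Integrable fun v : ι → ℝ => ∏ i, Real.exp (-(1 / 2) * v i ^ 2) :=
    Integrable.fintype_prod (μ := fun _ => volume)
      (f := fun _ x => Real.exp (-(1 / 2) * x ^ 2))
      fun _ => integrable_exp_neg_mul_sq (by norm_num)
  have h2 := h.lintegral_lt_top
  unfold gaussMass
  refine ne_of_lt (lt_of_eq_of_lt (lintegral_congr fun v => ?_) h2)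
  rw [← Real.exp_sum]
  congr 2
  rw [dotProduct, neg_div, Finset.sum_div, ← Finset.sum_neg_distrib]
  exact Finset.sum_congr rfl fun i _ => by ring

/-- Complete the square at `p = Q⁻¹S`, translate by `p`, and substitute `R(v - p)` with `R² = Q`;
the Jacobian is `(det Q)^(-1/2)`. The value of `gaussMass` is never needed: it cancels whenever two
such integrals are compared, so it only has to be nonzero and finite. -/
theorem lintegral_exp_quadratic {Q : Matrix ι ι ℝ} (hQ : Q.PosDef) (S : ι → ℝ) :
    ∫⁻ v : ι → ℝ, ENNReal.ofReal (Real.exp (v ⬝ᵥ S - (v ⬝ᵥ (Q *ᵥ v)) / 2)) =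
      ENNReal.ofReal (Real.exp ((S ⬝ᵥ (Q⁻¹ *ᵥ S) - Real.log Q.det) / 2)) * gaussMass ι := by
  obtain ⟨R, hRt, hRR, hdet⟩ := exists_symm_sqrt hQ
  have hQt : Qᵀ = Q := by simpa using hQ.isHermitian.eq
  have hu : IsUnit Q.det := hQ.det_pos.ne'.isUnit
  set p := Q⁻¹ *ᵥ S with hp
  have hQp : Q *ᵥ p = S := by
    rw [hp, Matrix.mulVec_mulVec, Matrix.mul_nonsing_inv _ hu, Matrix.one_mulVec]
  have key : ∀ v : ι → ℝ, ENNReal.ofReal (Real.exp (v ⬝ᵥ S - (v ⬝ᵥ (Q *ᵥ v)) / 2)) =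
      ENNReal.ofReal (Real.exp ((S ⬝ᵥ p) / 2)) *
        ENNReal.ofReal (Real.exp (-((R *ᵥ (v - p)) ⬝ᵥ (R *ᵥ (v - p))) / 2)) := by
    intro v
    rw [← ENNReal.ofReal_mul (Real.exp_pos _).le, ← Real.exp_add]
    congr 2
    have h1 : (R *ᵥ (v - p)) ⬝ᵥ (R *ᵥ (v - p)) = (v - p) ⬝ᵥ (Q *ᵥ (v - p)) := by
      rw [← hRR, ← Matrix.mulVec_mulVec, Matrix.dotProduct_mulVec (v - p) R,
        ← Matrix.mulVec_transpose, hRt]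
    rw [h1, Matrix.mulVec_sub, hQp, sub_dotProduct, dotProduct_sub, dotProduct_sub,
      dotProduct_mulVec_comm_of_symm hQt p v, hQp, dotProduct_comm p S]
    ring
  have hgm := measurable_gaussDensity (ι := ι)
  simp_rw [key]
  rw [lintegral_const_mul _ (by unfold dotProduct Matrix.mulVec dotProduct; fun_prop)]
  have h2 := lintegral_sub_right_eq_self (μ := (volume : Measure (ι → ℝ)))
    (fun v => ENNReal.ofReal (Real.exp (-((R *ᵥ v) ⬝ᵥ (R *ᵥ v)) / 2))) p
  rw [h2]
  have h3 : ∫⁻ v : ι → ℝ, ENNReal.ofReal (Real.exp (-((R *ᵥ v) ⬝ᵥ (R *ᵥ v)) / 2)) =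
      ENNReal.ofReal |R.det⁻¹| * gaussMass ι := by
    have h4 := lintegral_map (μ := (volume : Measure (ι → ℝ))) hgm
      (g := Matrix.toLin' R) (by unfold Matrix.toLin'; fun_prop)
    rw [Real.map_matrix_volume_pi_eq_smul_volume_pi hdet, lintegral_smul_measure] at h4
    simpa [gaussMass, smul_eq_mul] using h4.symm
  rw [h3, ← mul_assoc, ← ENNReal.ofReal_mul (Real.exp_pos _).le, sub_div, Real.exp_sub]
  congr 2
  have h5 : Q.det = |R.det| ^ 2 := by rw [← hRR, Matrix.det_mul, sq_abs, sq]
  rw [h5, Real.log_pow, abs_inv, div_eq_mul_inv (Real.exp _)]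
  congr 2
  rw [Nat.cast_ofNat, mul_div_cancel_left₀ _ two_ne_zero, Real.exp_log (abs_pos.2 hdet)]

end Gaussian

/-! ### Method of mixtures -/

section Mixture

set_option linter.unusedSectionVars false

variable {Ω ι : Type*} [mΩ : MeasurableSpace Ω] {P : Measure Ω} [IsProbabilityMeasure P]
  [Fintype ι] [DecidableEq ι]

theorem posDef_add_smul_one {G : Matrix ι ι ℝ} (hG : G.PosSemidef) {a : ℝ} (ha : 0 < a) :
    (G + a • (1 : Matrix ι ι ℝ)).PosDef :=
  Matrix.PosDef.posSemidef_add hG (Matrix.PosDef.one.smul ha)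

/-- Method of mixtures: the hypothesis for every fixed `v` is averaged over a centred Gaussian `v`
with precision `a`, and Tonelli moves the average inside. The inner integral is then Gaussian with
precision `G + a`, and `c` is the normalizing constant of the prior up to `gaussMass`. -/
theorem measurable_and_lintegral_mixture_le {S : Ω → ι → ℝ} {G : Ω → Matrix ι ι ℝ}
    (hS : Measurable S) (hG : ∀ i j, Measurable fun s => G s i j) (hpsd : ∀ s, (G s).PosSemidef)
    (hexp : ∀ v : ι → ℝ,
      ∫⁻ s, ENNReal.ofReal (Real.exp (v ⬝ᵥ S s - (v ⬝ᵥ (G s *ᵥ v)) / 2)) ∂P ≤ 1)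
    {a : ℝ} (ha : 0 < a) :
    (Measurable fun s => ENNReal.ofReal (Real.exp ((S s ⬝ᵥ ((G s + a • 1)⁻¹ *ᵥ S s)
        - Real.log (G s + a • 1).det + Fintype.card ι * Real.log a) / 2))) ∧
    ∫⁻ s, ENNReal.ofReal (Real.exp ((S s ⬝ᵥ ((G s + a • 1)⁻¹ *ᵥ S s)
        - Real.log (G s + a • 1).det + Fintype.card ι * Real.log a) / 2)) ∂P ≤ 1 := by
  have hS' : ∀ i, Measurable fun s => S s i := fun i => (measurable_pi_apply i).comp hS
  have hQ : ∀ s, (G s + a • (1 : Matrix ι ι ℝ)).PosDef := fun s => posDef_add_smul_one (hpsd s) ha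
  have hquad : ∀ s (v : ι → ℝ), v ⬝ᵥ ((G s + a • 1) *ᵥ v) = v ⬝ᵥ (G s *ᵥ v) + a * (v ⬝ᵥ v) := by
    intro s v
    rw [Matrix.add_mulVec, dotProduct_add, Matrix.smul_mulVec, Matrix.one_mulVec,
      dotProduct_smul, smul_eq_mul]
  have hprior := lintegral_exp_quadratic (posDef_add_smul_one (Matrix.PosSemidef.zero (n := ι)
    (R := ℝ)) ha) 0
  simp only [dotProduct_zero, zero_dotProduct, zero_add, Matrix.smul_mulVec, Matrix.one_mulVec,
    dotProduct_smul, Matrix.det_smul, Matrix.det_one, mul_one, smul_eq_mul, Real.log_pow] at hprior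
  set c := ENNReal.ofReal (Real.exp ((0 - Fintype.card ι * Real.log a) / 2)) with hc
  have hc0 : c ≠ 0 := by simp [hc, Real.exp_pos]
  have hmeas : Measurable (Function.uncurry fun (s : Ω) (v : ι → ℝ) =>
      ENNReal.ofReal (Real.exp (v ⬝ᵥ S s - (v ⬝ᵥ ((G s + a • 1) *ᵥ v)) / 2))) := by
    simp_rw [hquad]
    unfold dotProduct Matrix.mulVec dotProduct Function.uncurry
    simp only
    have h1 : ∀ i, Measurable fun x : Ω × (ι → ℝ) => S x.1 i :=
      fun i => (hS' i).comp measurable_fst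
    have h2 : ∀ i j, Measurable fun x : Ω × (ι → ℝ) => G x.1 i j :=
      fun i j => (hG i j).comp measurable_fst
    fun_prop
  have hswap : ∫⁻ s, (∫⁻ v : ι → ℝ, ENNReal.ofReal (Real.exp (v ⬝ᵥ S s
      - (v ⬝ᵥ ((G s + a • 1) *ᵥ v)) / 2)) ∂volume) ∂P ≤ c * gaussMass ι := by
    rw [lintegral_lintegral_swap hmeas.aemeasurable, ← hprior]
    refine lintegral_mono fun v => ?_
    have : ∀ s, ENNReal.ofReal (Real.exp (v ⬝ᵥ S s - (v ⬝ᵥ ((G s + a • 1) *ᵥ v)) / 2)) =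
        ENNReal.ofReal (Real.exp (v ⬝ᵥ S s - (v ⬝ᵥ (G s *ᵥ v)) / 2)) *
          ENNReal.ofReal (Real.exp (0 - a * (v ⬝ᵥ v) / 2)) := by
      intro s
      rw [← ENNReal.ofReal_mul (Real.exp_pos _).le, ← Real.exp_add, hquad]
      congr 2; ring
    simp_rw [this]
    rw [lintegral_mul_const' _ _ ENNReal.ofReal_ne_top]
    exact (mul_le_mul_left (hexp v) _).trans_eq (one_mul _)
  have hm := hmeas.lintegral_prod_right' (ν := (volume : Measure (ι → ℝ)))
  simp only [Function.uncurry] at hm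
  simp_rw [fun s => lintegral_exp_quadratic (hQ s) (S s)] at hswap hm
  rw [lintegral_mul_const' _ _ gaussMass_ne_top,
    ENNReal.mul_le_mul_iff_left gaussMass_ne_zero gaussMass_ne_top] at hswap
  have h3 : ∀ s, ENNReal.ofReal (Real.exp ((S s ⬝ᵥ ((G s + a • 1)⁻¹ *ᵥ S s)
        - Real.log (G s + a • 1).det + Fintype.card ι * Real.log a) / 2)) =
      ENNReal.ofReal (Real.exp ((S s ⬝ᵥ ((G s + a • 1)⁻¹ *ᵥ S s)
        - Real.log (G s + a • 1).det) / 2)) * c⁻¹ := by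
    intro s
    rw [hc, ← ENNReal.ofReal_inv_of_pos (Real.exp_pos _), ← Real.exp_neg,
      ← ENNReal.ofReal_mul (Real.exp_pos _).le, ← Real.exp_add]
    congr 2; ring
  simp_rw [h3]
  constructor
  -- Measurability of the closed form is inherited from the parametric integral it equals, so the
  -- inverse and the determinant need no separate treatment.
  · refine Measurable.mul_const ?_ _
    have h4 := hm.mul_const (gaussMass ι)⁻¹
    simp_rw [mul_assoc, ENNReal.mul_inv_cancel (gaussMass_ne_zero (ι := ι)) gaussMass_ne_top,
      mul_one] at h4
    exact h4
  · rw [lintegral_mul_const' _ _ (ENNReal.inv_ne_top.2 hc0)]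
    exact (mul_le_mul_left hswap _).trans_eq (ENNReal.mul_inv_cancel hc0 ENNReal.ofReal_ne_top)

/-- Self-normalized tail bound. -/
theorem measure_selfNormalized_gt_le {S : Ω → ι → ℝ} {G : Ω → Matrix ι ι ℝ}
    (hS : Measurable S) (hG : ∀ i j, Measurable fun s => G s i j) (hpsd : ∀ s, (G s).PosSemidef)
    (hexp : ∀ v : ι → ℝ,
      ∫⁻ s, ENNReal.ofReal (Real.exp (v ⬝ᵥ S s - (v ⬝ᵥ (G s *ᵥ v)) / 2)) ∂P ≤ 1)
    {a δ : ℝ} (ha : 0 < a) (hδ : 0 < δ) :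
    P {s | Real.log (G s + a • 1).det - Fintype.card ι * Real.log a + 2 * Real.log δ⁻¹ <
      S s ⬝ᵥ ((G s + a • 1)⁻¹ *ᵥ S s)} ≤ ENNReal.ofReal δ := by
  obtain ⟨hm, h⟩ := measurable_and_lintegral_mixture_le hS hG hpsd hexp ha
  -- Markov at level `δ⁻¹`; the factor 1/2 in the exponent is what makes the threshold `2 log δ⁻¹`.
  have h2 := meas_ge_le_lintegral_div (μ := P) hm.aemeasurable (ε := ENNReal.ofReal δ⁻¹)
    (by simpa using hδ) ENNReal.ofReal_ne_top
  refine (measure_mono fun s hs => ?_).trans (h2.trans ?_)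
  · simp only [Set.mem_ofPred_eq] at hs ⊢
    refine ENNReal.ofReal_le_ofReal ?_
    rw [← Real.log_le_iff_le_exp (inv_pos.2 hδ)]
    linarith
  · refine (ENNReal.div_le_div_right h _).trans ?_
    rw [ENNReal.ofReal_inv_of_pos hδ, one_div, inv_inv]

end Mixture

/-! ### Conditionally sub-Gaussian disturbances -/

/-- This and the next lemma mention a single σ-algebra on `Ω`, so that they can be instantiated
explicitly at the conditioning σ-algebra. -/
theorem measurable_indicator_fiber {Ω α : Type*} [MeasurableSpace Ω] [MeasurableSpace α]
    [MeasurableSingletonClass α] {W : Ω → α} (hW : Measurable W) {g : Ω → ENNReal}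
    (hg : Measurable g) (v : α) : Measurable ((W ⁻¹' {v}).indicator g) :=
  hg.indicator (hW (measurableSet_singleton v))

theorem exists_finite_range_approx {Ω ι : Type*} [MeasurableSpace Ω] [Finite ι] {V : Ω → ι → ℝ}
    (hV : Measurable V) : ∃ W : ℕ → Ω → ι → ℝ, (∀ n, Measurable (W n)) ∧
      (∀ n, ∃ R : Finset (ι → ℝ), ∀ s, W n s ∈ R) ∧
      ∀ s, Filter.Tendsto (fun n => W n s) Filter.atTop (nhds (V s)) :=
  ⟨fun n => hV.stronglyMeasurable.approx n, fun _ => SimpleFunc.measurable _,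
    fun _ => ⟨_, SimpleFunc.mem_range_self _⟩, hV.stronglyMeasurable.tendsto_approx⟩

section SubGaussian

set_option linter.unusedSectionVars false

variable {Ω ι : Type*} {m : MeasurableSpace Ω} [mΩ : MeasurableSpace Ω] {P : Measure Ω} [IsProbabilityMeasure P]
  [Fintype ι] [DecidableEq ι]

theorem dotProduct_smul_one_mulVec (c : ℝ) (v : ι → ℝ) :
    v ⬝ᵥ ((c • (1 : Matrix ι ι ℝ)) *ᵥ v) = c * (v ⬝ᵥ v) := by
  rw [Matrix.smul_mulVec, Matrix.one_mulVec, dotProduct_smul, smul_eq_mul]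

/-- The exponential weight of a fixed direction does not increase integrals of functions that are
measurable with respect to the conditioning σ-algebra. -/
theorem lintegral_mul_exp_const_le (hm : m ≤ mΩ) {X : Ω → ι → ℝ}
    (hX : Measurable X) {σ : ℝ} (hsub : IsCondSubGaussian P m X 0 (σ ^ 2 • 1)) (v : ι → ℝ)
    {g : Ω → ENNReal} (hg : Measurable[m] g) :
    ∫⁻ s, g s * ENNReal.ofReal (Real.exp (v ⬝ᵥ X s - σ ^ 2 * (v ⬝ᵥ v) / 2)) ∂P ≤
      ∫⁻ s, g s ∂P := by
  obtain ⟨hint, hle⟩ := hsub.2 v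
  simp only [sub_zero, dotProduct_smul_one_mulVec] at hint hle
  set f : Ω → ENNReal := fun s => ENNReal.ofReal (Real.exp (v ⬝ᵥ X s - σ ^ 2 * (v ⬝ᵥ v) / 2))
    with hf
  have hfm : Measurable f := by
    have h1 : ∀ i, Measurable fun s => X s i := fun i => (measurable_pi_apply i).comp hX
    simp only [hf]; unfold dotProduct; fun_prop
  have hset : ∀ t, MeasurableSet[m] t → ∫⁻ s in t, f s ∂P ≤ P t := by
    intro t ht
    set c := Real.exp (σ ^ 2 * (v ⬝ᵥ v) / 2) with hc
    have hc0 : 0 < c := Real.exp_pos _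
    have h1 : ∫ s in t, Real.exp (v ⬝ᵥ X s) ∂P ≤ c * P.real t := by
      rw [← setIntegral_condExp hm hint ht]
      refine (setIntegral_mono_ae integrable_condExp.integrableOn
        (integrable_const c).integrableOn hle).trans_eq ?_
      rw [setIntegral_const, smul_eq_mul, mul_comm]
    have h2 : ∀ s, f s = ENNReal.ofReal (Real.exp (v ⬝ᵥ X s)) * ENNReal.ofReal c⁻¹ := by
      intro s
      rw [hf, ← ENNReal.ofReal_mul (Real.exp_pos _).le, hc, ← Real.exp_neg, ← Real.exp_add]
      rfl
    simp_rw [h2]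
    rw [lintegral_mul_const' _ _ ENNReal.ofReal_ne_top,
      ← ofReal_integral_eq_lintegral_ofReal hint.integrableOn
        (Filter.Eventually.of_forall fun s => (Real.exp_pos _).le),
      ← ENNReal.ofReal_mul (setIntegral_nonneg (hm t ht) fun s _ => (Real.exp_pos _).le)]
    refine (ENNReal.ofReal_le_ofReal (q := P.real t) ?_).trans_eq (by simp)
    rw [← div_eq_mul_inv, div_le_iff₀ hc0, mul_comm]
    exact h1
  -- The conditional bound says exactly that, restricted to `m`, the measure with density `f` lies
  -- below `P`. Integrating an `m`-measurable `g` against both measures needs no integrability of `g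
  -- * f`.
  have hνle : (P.withDensity f).trim hm ≤ P.trim hm := by
    refine Measure.le_iff.2 fun t ht => ?_
    rw [trim_measurableSet_eq hm ht, trim_measurableSet_eq hm ht, withDensity_apply _ (hm t ht)]
    exact hset t ht
  calc ∫⁻ s, g s * f s ∂P = ∫⁻ s, g s ∂(P.withDensity f) := by
        rw [lintegral_withDensity_eq_lintegral_mul _ hfm (hg.mono hm le_rfl)]
        simp [mul_comm]
    _ = ∫⁻ s, g s ∂((P.withDensity f).trim hm) := (lintegral_trim hm hg).symm
    _ ≤ ∫⁻ s, g s ∂(P.trim hm) := lintegral_mono' hνle le_rfl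
    _ = ∫⁻ s, g s ∂P := lintegral_trim hm hg

/-- The same with a direction that is measurable with respect to the conditioning σ-algebra. -/
theorem lintegral_mul_exp_le (hm : m ≤ mΩ) {X : Ω → ι → ℝ}
    (hX : Measurable X) {σ : ℝ} (hsub : IsCondSubGaussian P m X 0 (σ ^ 2 • 1)) {V : Ω → ι → ℝ}
    (hV : Measurable[m] V) {g : Ω → ENNReal} (hg : Measurable[m] g) :
    ∫⁻ s, g s * ENNReal.ofReal (Real.exp (V s ⬝ᵥ X s - σ ^ 2 * (V s ⬝ᵥ V s) / 2)) ∂P ≤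
      ∫⁻ s, g s ∂P := by
  have hX' : ∀ i, Measurable fun s => X s i := fun i => (measurable_pi_apply i).comp hX
  have hsimple : ∀ (W : Ω → ι → ℝ) (R : Finset (ι → ℝ)), Measurable[m] W → (∀ s, W s ∈ R) →
      ∫⁻ s, g s * ENNReal.ofReal (Real.exp (W s ⬝ᵥ X s - σ ^ 2 * (W s ⬝ᵥ W s) / 2)) ∂P ≤
        ∫⁻ s, g s ∂P := by
    intro W R hW hR
    have hgv : ∀ v, Measurable[m] ((W ⁻¹' {v}).indicator g) :=
      @measurable_indicator_fiber Ω _ m _ _ _ hW _ hg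
    -- A direction with finitely many values is constant on each fibre, so `g` is split over the
    -- fibres and the fixed-direction bound applies to each piece.
    have h1 : ∀ (h : (ι → ℝ) → Ω → ENNReal) (s : Ω),
        ∑ v ∈ R, (W ⁻¹' {v}).indicator g s * h v s = g s * h (W s) s := by
      intro h s
      rw [Finset.sum_eq_single (W s)]
      · simp
      · intro v _ hv
        rw [Set.indicator_of_notMem (by simpa using hv.symm), zero_mul]
      · intro hs
        exact absurd (hR s) hs
    simp_rw [← h1 (fun v s => ENNReal.ofReal (Real.exp (v ⬝ᵥ X s - σ ^ 2 * (v ⬝ᵥ v) / 2)))]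
    have h2 : ∀ s, g s = ∑ v ∈ R, (W ⁻¹' {v}).indicator g s := by
      intro s; simpa using (h1 (fun _ _ => 1) s).symm
    rw [lintegral_congr h2, lintegral_finsetSum, lintegral_finsetSum]
    · exact Finset.sum_le_sum fun v _ => lintegral_mul_exp_const_le hm hX hsub v (hgv v)
    · exact fun v _ => (hgv v).mono hm le_rfl
    · intro v _
      refine ((hgv v).mono hm le_rfl).mul ?_
      unfold dotProduct; fun_prop
  obtain ⟨W, hWm, hWR, hWt⟩ := @exists_finite_range_approx Ω ι m _ _ hV
  choose R hR using hWR
  set f : ℕ → Ω → ENNReal := fun n s => g s * ENNReal.ofReal (Real.exp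
    (W n s ⬝ᵥ X s - σ ^ 2 * (W n s ⬝ᵥ W n s) / 2)) with hf
  have hfm : ∀ n, Measurable (f n) := by
    intro n
    refine (hg.mono hm le_rfl).mul ?_
    have : ∀ i, Measurable fun s => W n s i := fun i =>
      (measurable_pi_apply i).comp ((hWm n).mono hm le_rfl)
    unfold dotProduct; fun_prop
  have hlim : ∀ s, Filter.liminf (fun n => f n s) Filter.atTop =
      g s * ENNReal.ofReal (Real.exp (V s ⬝ᵥ X s - σ ^ 2 * (V s ⬝ᵥ V s) / 2)) := by
    intro s
    refine Filter.Tendsto.liminf_eq ?_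
    have hc : Continuous fun v : ι → ℝ => Real.exp (v ⬝ᵥ X s - σ ^ 2 * (v ⬝ᵥ v) / 2) := by
      unfold dotProduct; fun_prop
    have h3 := (hc.tendsto _).comp (hWt s)
    refine ENNReal.Tendsto.const_mul (ENNReal.tendsto_ofReal h3) (Or.inl ?_)
    simp [Real.exp_pos]
  simp_rw [← hlim]
  -- Fatou passes from finite-range directions to `V`; only pointwise convergence is available, with
  -- no dominating function.
  refine (lintegral_liminf_le hfm).trans ?_
  refine (Filter.liminf_le_liminf (v := fun _ => ∫⁻ s, g s ∂P)
    (Filter.Eventually.of_forall fun n => hsimple (W n) (R n) (hWm n) (hR n))).trans_eq ?_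
  simp

/-- The exponential supermartingale of a predictable sequence of directions. -/
theorem lintegral_exp_sum_le_one (ℱ : Filtration ℕ mΩ) {w : ℕ → Ω → ι → ℝ}
    (hw : ∀ k, Measurable[ℱ (k + 1)] (w k)) {σ : ℝ}
    (hsub : ∀ k, IsCondSubGaussian P (ℱ k) (w k) 0 (σ ^ 2 • 1)) {V : ℕ → Ω → ι → ℝ}
    (hV : ∀ k, Measurable[ℱ k] (V k)) (n : ℕ) :
    ∫⁻ s, ENNReal.ofReal (Real.exp (∑ k ∈ Finset.range n,
      (V k s ⬝ᵥ w k s - σ ^ 2 * (V k s ⬝ᵥ V k s) / 2))) ∂P ≤ 1 := by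
  induction n with
  | zero => simp
  | succ n ih =>
    refine le_trans ?_ ih
    -- All past factors are known at time `n`: `w k` is `ℱ (k + 1)`-measurable and `k + 1 ≤ n`. They
    -- play the role of `g` in the one-step bound.
    have hm : Measurable[ℱ n] fun s => ENNReal.ofReal (Real.exp (∑ k ∈ Finset.range n,
        (V k s ⬝ᵥ w k s - σ ^ 2 * (V k s ⬝ᵥ V k s) / 2))) := by
      have h1 : ∀ k ∈ Finset.range n, ∀ i, Measurable[ℱ n] fun s => V k s i := fun k hk i =>
        (measurable_pi_apply i).comp
          ((hV k).mono (ℱ.mono (Finset.mem_range.1 hk).le) le_rfl)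
      have h2 : ∀ k ∈ Finset.range n, ∀ i, Measurable[ℱ n] fun s => w k s i := fun k hk i =>
        (measurable_pi_apply i).comp
          ((hw k).mono (ℱ.mono (Nat.succ_le_of_lt (Finset.mem_range.1 hk))) le_rfl)
      refine ENNReal.measurable_ofReal.comp (Real.measurable_exp.comp ?_)
      refine Finset.measurable_sum _ fun k hk => ?_
      have h1' := h1 k hk
      have h2' := h2 k hk
      unfold dotProduct
      refine Measurable.sub ?_ (Measurable.div_const (Measurable.const_mul ?_ _) _)
      · exact Finset.measurable_sum _ fun i _ => (h1' i).mul (h2' i)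
      · exact Finset.measurable_sum _ fun i _ => (h1' i).mul (h1' i)
    refine le_trans (lintegral_mono fun s => ?_) (lintegral_mul_exp_le (ℱ.le n)
      ((hw n).mono (ℱ.le _) le_rfl) (hsub n) (hV n) hm)
    rw [Finset.sum_range_succ, Real.exp_add, ENNReal.ofReal_mul (Real.exp_pos _).le]

/-- With zero proxy variance both `exp(X_i)` and `exp(-X_i)` have mean at most 1, while `exp x +
exp(-x) ≥ 2` with equality only at 0. This covers `σ = 0`, where the mixture argument has no
positive precision to use. -/
theorem ae_eq_zero_of_subGaussian_zero (hm : m ≤ mΩ) {X : Ω → ι → ℝ}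
    (hsub : IsCondSubGaussian P m X 0 ((0 : ℝ) ^ 2 • 1)) : ∀ᵐ s ∂P, X s = 0 := by
  have hle : ∀ v : ι → ℝ, Integrable (fun s => Real.exp (v ⬝ᵥ X s)) P ∧
      ∫ s, Real.exp (v ⬝ᵥ X s) ∂P ≤ 1 := by
    intro v
    obtain ⟨hint, hle⟩ := hsub.2 v
    simp only [sub_zero, dotProduct_smul_one_mulVec] at hint hle
    refine ⟨hint, ?_⟩
    rw [← integral_condExp hm]
    refine (integral_mono_ae integrable_condExp (integrable_const _) hle).trans_eq ?_
    simp
  have hcoord : ∀ i, ∀ᵐ s ∂P, X s i = 0 := by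
    intro i
    obtain ⟨i1, h1⟩ := hle (Pi.single i 1)
    obtain ⟨i2, h2⟩ := hle (Pi.single i (-1))
    simp only [single_dotProduct, one_mul, neg_mul] at i1 h1 i2 h2
    have hnn : ∀ x : ℝ, 0 ≤ Real.exp x + Real.exp (-x) - 2 := by
      intro x
      have := Real.add_one_le_exp x
      have := Real.add_one_le_exp (-x)
      linarith
    have h3 : ∫ s, (Real.exp (X s i) + Real.exp (-X s i) - 2) ∂P = 0 := by
      refine le_antisymm ?_ (integral_nonneg fun s => hnn _)
      have i12 : Integrable (fun s => Real.exp (X s i) + Real.exp (-X s i)) P := i1.add i2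
      rw [integral_sub i12 (integrable_const _), integral_add i1 i2]
      simp only [integral_const, probReal_univ, smul_eq_mul, one_mul]
      linarith
    rw [integral_eq_zero_iff_of_nonneg (fun s => hnn _)
      ((i1.add i2).sub (integrable_const _))] at h3
    filter_upwards [h3] with s hs
    by_contra hne
    have := Real.add_one_lt_exp hne
    have := Real.add_one_le_exp (-X s i)
    simp only [Pi.zero_apply] at hs
    linarith
  filter_upwards [ae_all_iff.2 hcoord] with s hs
  exact funext hs

end SubGaussian

/-! ### Tail bounds for the experiment -/

section Tail

variable {nx nu : ℕ}

/-- `(w_0, …, w_(T-1))`, stacked. -/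
def stackedNoise (T : ℕ) (w : ℕ → Fin nx → ℝ) : Fin T × Fin nx → ℝ :=
  fun p => w p.1 p.2

theorem kronecker_one_mulVec_apply {T : ℕ} (Phi : Matrix (Fin nx ⊕ Fin nu) (Fin T) ℝ)
    (X : Fin T × Fin nx → ℝ) (p : (Fin nx ⊕ Fin nu) × Fin nx) :
    ((Phi ⊗ₖ (1 : Matrix (Fin nx) (Fin nx) ℝ)) *ᵥ X) p = ∑ k, Phi p.1 k * X (k, p.2) := by
  simp [Matrix.mulVec, dotProduct, Fintype.sum_prod_type, Matrix.kroneckerMap_apply,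
    Matrix.one_apply]

theorem transpose_kronecker_one_mulVec_apply {T : ℕ} (Phi : Matrix (Fin nx ⊕ Fin nu) (Fin T) ℝ)
    (v : (Fin nx ⊕ Fin nu) × Fin nx → ℝ) (p : Fin T × Fin nx) :
    ((Phi ⊗ₖ (1 : Matrix (Fin nx) (Fin nx) ℝ))ᵀ *ᵥ v) p = ∑ a, Phi a p.1 * v (a, p.2) := by
  simp only [Matrix.mulVec, dotProduct, Fintype.sum_prod_type, Matrix.kroneckerMap_apply,
    Matrix.one_apply, Matrix.transpose_apply]
  simp

theorem gram_kronecker_one {T : ℕ} (Phi : Matrix (Fin nx ⊕ Fin nu) (Fin T) ℝ) :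
    (Phi * Phiᵀ) ⊗ₖ (1 : Matrix (Fin nx) (Fin nx) ℝ) =
      (Phi ⊗ₖ (1 : Matrix (Fin nx) (Fin nx) ℝ)) *
        (Phi ⊗ₖ (1 : Matrix (Fin nx) (Fin nx) ℝ))ᵀ := by
  rw [← Matrix.kroneckerMap_transpose, Matrix.transpose_one, ← Matrix.mul_kronecker_mul,
    Matrix.one_mul]

theorem posSemidef_gram_kronecker_one {T : ℕ} (Phi : Matrix (Fin nx ⊕ Fin nu) (Fin T) ℝ) :
    ((Phi * Phiᵀ) ⊗ₖ (1 : Matrix (Fin nx) (Fin nx) ℝ)).PosSemidef := by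
  rw [gram_kronecker_one]
  simpa using Matrix.posSemidef_self_mul_conjTranspose (Phi ⊗ₖ (1 : Matrix (Fin nx) (Fin nx) ℝ))

theorem posDef_Dbar {T : ℕ} {lam : ℝ} (hlam : 0 < lam)
    (Phi : Matrix (Fin nx ⊕ Fin nu) (Fin T) ℝ) : (Dbar lam Phi).PosDef :=
  posDef_add_smul_one (posSemidef_gram_kronecker_one Phi) hlam

variable {Ω : Type*} [mΩ : MeasurableSpace Ω] {P : Measure Ω} [IsProbabilityMeasure P]

theorem measurable_state (A : Matrix (Fin nx) (Fin nx) ℝ) (B : Matrix (Fin nx) (Fin nu) ℝ)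
    (u : ℕ → Fin nu → ℝ) (ℱ : Filtration ℕ mΩ) {w : ℕ → Ω → Fin nx → ℝ}
    (hw : ∀ k, Measurable[ℱ (k + 1)] (w k)) (k : ℕ) (i : Fin nx) :
    Measurable[ℱ k] fun s => state A B u (fun k => w k s) k i := by
  induction k generalizing i with
  | zero => simp only [state, Pi.zero_apply]; exact measurable_const
  | succ k ih =>
    simp only [state, Pi.add_apply, Matrix.mulVec, dotProduct]
    refine Measurable.add (Measurable.add ?_ measurable_const)
      ((measurable_pi_apply i).comp (hw k))
    exact Finset.measurable_sum _ fun j _ =>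
      ((ih j).mono (ℱ.mono k.le_succ) le_rfl).const_mul _

/-- `vᵀS` is a sum of `V_k · w_k` with `V_k` predictable, since `x_k` depends only on earlier noise.
The prior precision is chosen as `σ²λ`, so that `G + a = σ²D̄` and the powers of `σ²` cancel between
the determinant and `log a`. -/
theorem measure_noise_selfNormalized_le (A : Matrix (Fin nx) (Fin nx) ℝ)
    (B : Matrix (Fin nx) (Fin nu) ℝ) (u : ℕ → Fin nu → ℝ) (T : ℕ) (ℱ : Filtration ℕ mΩ)
    {w : ℕ → Ω → Fin nx → ℝ} (hw : ∀ k, Measurable[ℱ (k + 1)] (w k)) {σ : ℝ} (hσ : 0 < σ)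
    (hsub : ∀ k, IsCondSubGaussian P (ℱ k) (w k) 0 (σ ^ 2 • 1)) {lam δ : ℝ} (hlam : 0 < lam)
    (hδ : 0 < δ) {Phi : Ω → Matrix (Fin nx ⊕ Fin nu) (Fin T) ℝ}
    (hPhi : ∀ s, Phi s = regressor T (state A B u fun k => w k s) u) {S : Ω → _}
    (hS : ∀ s, S s = (Phi s ⊗ₖ (1 : Matrix (Fin nx) (Fin nx) ℝ)) *ᵥ
      stackedNoise T fun k => w k s) :
    P {s | σ ^ 2 * (Real.log (Dbar lam (Phi s)).det - ((nx * (nx + nu) : ℕ) : ℝ) * Real.log lam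
      + 2 * Real.log δ⁻¹) < S s ⬝ᵥ ((Dbar lam (Phi s))⁻¹ *ᵥ S s)} ≤ ENNReal.ofReal δ := by
  have hσ2 : 0 < σ ^ 2 := by positivity
  set φ : ℕ → Ω → Fin nx ⊕ Fin nu → ℝ :=
    fun k s => Sum.elim (state A B u (fun k => w k s) k) (u k) with hφ
  have hφm : ∀ k a, Measurable[ℱ k] fun s => φ k s a := by
    rintro k (i | j)
    · exact measurable_state A B u ℱ hw k i
    · exact measurable_const
  have hPa : ∀ s a k, Phi s a k = φ k s a := by intro s a k; rw [hPhi]; rfl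
  have hPm : ∀ a k, Measurable fun s => Phi s a k := by
    intro a k
    simp_rw [hPa]
    exact (hφm k a).mono (ℱ.le _) le_rfl
  have hwm : ∀ k i, Measurable fun s => w k s i := fun k i =>
    (measurable_pi_apply i).comp ((hw k).mono (ℱ.le _) le_rfl)
  have hSm : Measurable S := by
    refine measurable_pi_iff.2 fun p => ?_
    simp_rw [hS, kronecker_one_mulVec_apply, stackedNoise]
    exact Finset.measurable_sum _ fun k _ => (hPm _ _).mul (hwm _ _)
  set G : Ω → Matrix ((Fin nx ⊕ Fin nu) × Fin nx) ((Fin nx ⊕ Fin nu) × Fin nx) ℝ :=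
    fun s => σ ^ 2 • ((Phi s * (Phi s)ᵀ) ⊗ₖ (1 : Matrix (Fin nx) (Fin nx) ℝ)) with hG
  have hGm : ∀ p q, Measurable fun s => G s p q := by
    intro p q
    simp only [hG, Matrix.smul_apply, Matrix.kroneckerMap_apply, Matrix.mul_apply,
      Matrix.transpose_apply, smul_eq_mul]
    exact ((Finset.measurable_sum _ fun k _ => (hPm _ _).mul (hPm _ _)).mul_const _).const_mul _
  have hGp : ∀ s, (G s).PosSemidef := fun s => (posSemidef_gram_kronecker_one _).smul hσ2.le
  have hexp : ∀ v, ∫⁻ s, ENNReal.ofReal (Real.exp (v ⬝ᵥ S s - (v ⬝ᵥ (G s *ᵥ v)) / 2)) ∂P ≤ 1 := by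
    intro v
    set V : ℕ → Ω → Fin nx → ℝ := fun k s i => ∑ a, φ k s a * v (a, i) with hV
    have hVm : ∀ k, Measurable[ℱ k] (V k) := fun k =>
      @measurable_pi_lambda Ω _ _ (ℱ k) _ _ fun i => Finset.measurable_sum _ fun a _ => (hφm k a).mul_const _
    refine le_of_eq_of_le (lintegral_congr fun s => ?_)
      (lintegral_exp_sum_le_one ℱ hw hsub hVm T)
    have hMt : ∀ p : Fin T × Fin nx,
        ((Phi s ⊗ₖ (1 : Matrix (Fin nx) (Fin nx) ℝ))ᵀ *ᵥ v) p = V p.1 s p.2 := by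
      intro p
      rw [transpose_kronecker_one_mulVec_apply]
      simp_rw [hPa]; rfl
    have h1 : v ⬝ᵥ S s = ∑ k ∈ Finset.range T, V k s ⬝ᵥ w k s := by
      rw [hS, Matrix.dotProduct_mulVec, ← Matrix.mulVec_transpose, dotProduct,
        Fintype.sum_prod_type, Finset.sum_range]
      simp_rw [hMt]; rfl
    have h2 : v ⬝ᵥ (G s *ᵥ v) = σ ^ 2 * ∑ k ∈ Finset.range T, V k s ⬝ᵥ V k s := by
      rw [hG, Matrix.smul_mulVec, dotProduct_smul, smul_eq_mul, gram_kronecker_one,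
        ← Matrix.mulVec_mulVec, Matrix.dotProduct_mulVec, ← Matrix.mulVec_transpose, dotProduct,
        Fintype.sum_prod_type, Finset.sum_range]
      simp_rw [hMt]; rfl
    rw [h1, h2, Finset.sum_sub_distrib, ← Finset.sum_div, ← Finset.mul_sum]
  have h := measure_selfNormalized_gt_le hSm hGm hGp hexp (mul_pos hσ2 hlam) hδ
  refine le_of_eq_of_le (congrArg P (Set.ext fun s => ?_)) h
  have hQ : G s + (σ ^ 2 * lam) • 1 = σ ^ 2 • Dbar lam (Phi s) := by
    rw [Dbar, smul_add, smul_smul]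
  have hdet := (posDef_Dbar hlam (Phi s)).det_pos
  have hcard : Fintype.card ((Fin nx ⊕ Fin nu) × Fin nx) = nx * (nx + nu) := by
    simp [mul_comm]
  have hinv : (σ ^ 2 • Dbar lam (Phi s))⁻¹ = (σ ^ 2)⁻¹ • (Dbar lam (Phi s))⁻¹ := by
    rw [← Units.smul_mk0 hσ2.ne', Matrix.inv_smul' _ _ hdet.ne'.isUnit]
    rfl
  simp only [Set.mem_ofPred_eq]
  rw [hQ, hinv, Matrix.det_smul, Real.log_mul (by positivity) hdet.ne', Real.log_pow, hcard,
    Real.log_mul hσ2.ne' hlam.ne', Matrix.smul_mulVec, dotProduct_smul, smul_eq_mul,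
    ← div_eq_inv_mul, lt_div_iff₀ hσ2]
  constructor <;> intro h' <;> linarith

/-- The same mixture bound with deterministic directions and constant `G = σ²I`. Precision `a =
σ²/2` makes the total `3σ²/2`, giving the threshold `3σ²/2 · (T nx log 3 + 2 log δ⁻¹)`. -/
theorem measure_noise_energy_le (T : ℕ) (ℱ : Filtration ℕ mΩ)
    {w : ℕ → Ω → Fin nx → ℝ} (hw : ∀ k, Measurable[ℱ (k + 1)] (w k)) {σ : ℝ} (hσ : 0 < σ)
    (hsub : ∀ k, IsCondSubGaussian P (ℱ k) (w k) 0 (σ ^ 2 • 1)) {δ : ℝ}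
    (hδ : 0 < δ) :
    P {s | 3 / 4 * gammaW nx T σ δ <
      (stackedNoise T fun k => w k s) ⬝ᵥ (stackedNoise T fun k => w k s)} ≤
        ENNReal.ofReal δ := by
  have hσ2 : 0 < σ ^ 2 := by positivity
  set S : Ω → Fin T × Fin nx → ℝ := fun s => stackedNoise T fun k => w k s with hS
  have hSm : Measurable S := measurable_pi_iff.2 fun p =>
    (measurable_pi_apply _).comp ((hw p.1).mono (ℱ.le _) le_rfl)
  have hexp : ∀ v, ∫⁻ s, ENNReal.ofReal (Real.exp (v ⬝ᵥ S s
      - (v ⬝ᵥ ((σ ^ 2 • (1 : Matrix (Fin T × Fin nx) (Fin T × Fin nx) ℝ)) *ᵥ v)) / 2)) ∂P ≤ 1 := by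
    intro v
    -- The value 0 beyond `T` is arbitrary: only indices below `T` are summed.
    set V : ℕ → Fin nx → ℝ := fun k i => if h : k < T then v (⟨k, h⟩, i) else 0 with hV
    refine le_of_eq_of_le (lintegral_congr fun s => ?_)
      (lintegral_exp_sum_le_one ℱ hw hsub (V := fun k _ => V k) (fun k => measurable_const) T)
    have hVk : ∀ (k : Fin T) i, V k i = v (k, i) := by intro k i; simp [hV]
    rw [dotProduct_smul_one_mulVec, Finset.sum_sub_distrib, ← Finset.sum_div, ← Finset.mul_sum,
      Finset.sum_range, Finset.sum_range]
    simp only [dotProduct, Fintype.sum_prod_type, hVk]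
    rfl
  have h := measure_selfNormalized_gt_le (P := P) (S := S) (G := fun _ => σ ^ 2 • 1) hSm
    (fun i j => measurable_const) (fun _ => Matrix.PosSemidef.one.smul hσ2.le) hexp
    (half_pos hσ2) hδ
  have hQ : (σ ^ 2 • (1 : Matrix (Fin T × Fin nx) (Fin T × Fin nx) ℝ)) + (σ ^ 2 / 2) • 1 =
      (3 / 2 * σ ^ 2) • 1 := by
    rw [← add_smul]; congr 1; ring
  have hinv : ((3 / 2 * σ ^ 2) • (1 : Matrix (Fin T × Fin nx) (Fin T × Fin nx) ℝ))⁻¹ =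
      (3 / 2 * σ ^ 2)⁻¹ • 1 := by
    rw [Matrix.inv_eq_left_inv]
    rw [smul_mul_smul_comm, inv_mul_cancel₀ (by positivity), one_smul, one_mul]
  simp only [hQ, hinv, Matrix.det_smul, Matrix.det_one, mul_one, Real.log_pow,
    dotProduct_smul_one_mulVec] at h
  refine (measure_mono fun s hs => ?_).trans h
  rw [Set.mem_ofPred_eq] at hs ⊢
  rw [← div_eq_inv_mul, lt_div_iff₀ (by positivity)]
  refine lt_of_le_of_lt ?_ hs
  have h3 : Real.log (3 / 2 * σ ^ 2) = Real.log 3 + Real.log (σ ^ 2 / 2) := by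
    rw [← Real.log_mul three_ne_zero (half_pos hσ2).ne']; congr 1; ring
  rw [h3]
  -- Equivalent to `log (9/4) ≤ 1`; this is what leaves room for the factor 3/4 in front of `γ_w`.
  have hlog : 2 * Real.log 3 ≤ 1 + Real.log 4 := by
    have h9 : Real.log (9 / 4) ≤ 1 := by
      rw [Real.log_le_iff_le_exp (by norm_num)]
      exact le_trans (by norm_num) Real.exp_one_gt_d9.le
    rw [Real.log_div (by norm_num) (by norm_num), show (9 : ℝ) = 3 ^ 2 by norm_num,
      Real.log_pow] at h9
    push_cast at h9
    linarith
  have hn : (0 : ℝ) ≤ σ ^ 2 * (T * nx) := by positivity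
  have h4 := mul_le_mul_of_nonneg_left hlog hn
  simp only [gammaW, Fintype.card_prod, Fintype.card_fin]
  push_cast
  linarith

/-- Off an event of probability `2δ`, the noise satisfies both tail bounds. -/
theorem measure_bad_noise_le (A : Matrix (Fin nx) (Fin nx) ℝ)
    (B : Matrix (Fin nx) (Fin nu) ℝ) (u : ℕ → Fin nu → ℝ) (T : ℕ) (ℱ : Filtration ℕ mΩ)
    {w : ℕ → Ω → Fin nx → ℝ} (hw : ∀ k, Measurable[ℱ (k + 1)] (w k)) {σ : ℝ} (hσ : 0 ≤ σ)
    (hsub : ∀ k, IsCondSubGaussian P (ℱ k) (w k) 0 (σ ^ 2 • 1)) {lam δ : ℝ} (hlam : 0 < lam)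
    (hδ : 0 < δ) {Phi : Ω → Matrix (Fin nx ⊕ Fin nu) (Fin T) ℝ}
    (hPhi : ∀ s, Phi s = regressor T (state A B u fun k => w k s) u) {S : Ω → _}
    (hS : ∀ s, S s = (Phi s ⊗ₖ (1 : Matrix (Fin nx) (Fin nx) ℝ)) *ᵥ
      stackedNoise T fun k => w k s) :
    P {s | ¬ (S s ⬝ᵥ ((Dbar lam (Phi s))⁻¹ *ᵥ S s) ≤ σ ^ 2 * (Real.log (Dbar lam (Phi s)).det
        - ((nx * (nx + nu) : ℕ) : ℝ) * Real.log lam + 2 * Real.log δ⁻¹) ∧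
      (stackedNoise T fun k => w k s) ⬝ᵥ (stackedNoise T fun k => w k s) ≤
        3 / 4 * gammaW nx T σ δ)} ≤ ENNReal.ofReal (2 * δ) := by
  rcases hσ.eq_or_lt with rfl | hσ
  -- For `σ = 0` the noise vanishes almost surely and both bounds read `0 ≤ 0`.
  · refine le_of_eq_of_le ?_ zero_le
    rw [← ae_iff]
    filter_upwards [ae_all_iff.2 fun k => ae_eq_zero_of_subGaussian_zero (ℱ.le k) (hsub k)] with s hs
    have h0 : (stackedNoise T fun k => w k s) = 0 := by
      funext p; simp [stackedNoise, hs]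
    rw [hS, h0]
    simp [gammaW]
  · rw [two_mul δ, ENNReal.ofReal_add hδ.le hδ.le]
    refine le_trans (measure_mono ?_) ((measure_union_le _ _).trans (add_le_add
      (measure_noise_selfNormalized_le A B u T ℱ hw hσ hsub hlam hδ hPhi hS)
      (measure_noise_energy_le T ℱ hw hσ hsub hδ)))
    intro s hs
    simp only [Set.mem_ofPred_eq, Set.mem_union, not_and_or, not_le] at hs ⊢
    exact hs

end Tail

/-! ### Euclidean and spectral norms -/

section Norms

variable {m n : Type*} [Fintype m] [Fintype n]

theorem euclNorm_eq_norm (v : n → ℝ) : euclNorm v = ‖WithLp.toLp 2 v‖ := by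
  rw [euclNorm, EuclideanSpace.norm_eq]
  simp [dotProduct, sq]

theorem euclNorm_nonneg (v : n → ℝ) : 0 ≤ euclNorm v := Real.sqrt_nonneg _

theorem euclNorm_sq (v : n → ℝ) : euclNorm v ^ 2 = v ⬝ᵥ v :=
  Real.sq_sqrt (dotProduct_self_nonneg' v)

theorem euclNorm_add_le (v w : n → ℝ) : euclNorm (v + w) ≤ euclNorm v + euclNorm w := by
  simp only [euclNorm_eq_norm, WithLp.toLp_add]
  exact norm_add_le _ _

theorem specNorm_nonneg [DecidableEq n] (M : Matrix m n ℝ) : 0 ≤ specNorm M := by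
  let _ := Matrix.instL2OpNormedAddCommGroup (m := m) (n := n) (𝕜 := ℝ)
  exact norm_nonneg M

theorem euclNorm_mulVec_le [DecidableEq n] (M : Matrix m n ℝ) (v : n → ℝ) :
    euclNorm (M *ᵥ v) ≤ specNorm M * euclNorm v := by
  simp only [euclNorm_eq_norm]
  exact Matrix.l2_opNorm_mulVec M (WithLp.toLp 2 v)

theorem sq_dotProduct_le (v w : n → ℝ) : (v ⬝ᵥ w) ^ 2 ≤ (v ⬝ᵥ v) * (w ⬝ᵥ w) := by
  simpa [dotProduct, sq] using Finset.sum_mul_sq_le_sq_mul_sq Finset.univ v w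

end Norms

/-! ### Sums of sinusoids -/

theorem sum_pow_of_pow_eq_one {T : ℕ} {z : ℂ} (hz : z ^ T = 1) :
    ∑ k ∈ Finset.range T, z ^ k = if z = 1 then (T : ℂ) else 0 := by
  split_ifs with h
  · simp [h]
  · rw [geom_sum_eq h, hz, sub_self, zero_div]

/-- Expand the square with `Re x Re y = (Re(x ȳ) + Re(xy)) / 2`. The first family of sums over `k`
is diagonal because distinct roots of unity are orthogonal; the second is only shown nonnegative,
and dropping it costs the factor 1/2. -/
theorem half_sum_normSq_le_sum_sq {ι : Type*} [Fintype ι] [DecidableEq ι] {T : ℕ} {ζ c : ι → ℂ}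
    (hT : ∀ i, ζ i ^ T = 1) (hone : ∀ i, ‖ζ i‖ = 1) (hinj : Function.Injective ζ)
    (hconj : ∀ i j, ζ i * ζ j = 1 → c j = starRingEnd ℂ (c i)) :
    (T : ℝ) / 2 * ∑ i, Complex.normSq (c i) ≤
      ∑ k ∈ Finset.range T, (∑ i, (c i * ζ i ^ k).re) ^ 2 := by
  have hre : ∀ x y : ℂ, x.re * y.re = ((x * starRingEnd ℂ y).re + (x * y).re) / 2 := by
    intro x y; simp
  have hconjζ : ∀ i, starRingEnd ℂ (ζ i) = (ζ i)⁻¹ := fun i =>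
    (Complex.inv_eq_conj (hone i)).symm
  have hne : ∀ i, ζ i ≠ 0 := fun i h => by simpa [h] using hone i
  have h1 : ∀ i j, ∑ k ∈ Finset.range T, (c i * ζ i ^ k) * starRingEnd ℂ (c j * ζ j ^ k) =
      if i = j then (T : ℂ) * Complex.normSq (c i) else 0 := by
    intro i j
    have : ∀ k, (c i * ζ i ^ k) * starRingEnd ℂ (c j * ζ j ^ k) =
        (c i * starRingEnd ℂ (c j)) * (ζ i * (ζ j)⁻¹) ^ k := by
      intro k; rw [map_mul, map_pow, hconjζ, mul_pow]; ring
    simp_rw [this]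
    rw [← Finset.mul_sum, sum_pow_of_pow_eq_one (by rw [mul_pow, inv_pow, hT, hT]; simp)]
    have hiff : ζ i * (ζ j)⁻¹ = 1 ↔ i = j := by
      rw [mul_inv_eq_one₀ (hne j)]; exact hinj.eq_iff
    simp only [hiff]
    split_ifs with h
    · rw [h, Complex.mul_conj, mul_comm]
    · simp
  -- The sum survives only when `ζ_i ζ_j = 1`; then `c_j` is the conjugate of `c_i` and the product
  -- is `|c_i|²`. Without the mirror condition these terms could be negative.
  have h2 : ∀ i j, 0 ≤ (∑ k ∈ Finset.range T, (c i * ζ i ^ k) * (c j * ζ j ^ k)).re := by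
    intro i j
    have : ∀ k, (c i * ζ i ^ k) * (c j * ζ j ^ k) = (c i * c j) * (ζ i * ζ j) ^ k := by
      intro k; rw [mul_pow]; ring
    simp_rw [this]
    rw [← Finset.mul_sum, sum_pow_of_pow_eq_one (by rw [mul_pow, hT, hT, one_mul])]
    split_ifs with h
    · rw [hconj i j h, Complex.mul_conj, ← Complex.ofReal_natCast, ← Complex.ofReal_mul,
        Complex.ofReal_re]
      exact mul_nonneg (Complex.normSq_nonneg _) T.cast_nonneg
    · simp
  have h3 : ∑ k ∈ Finset.range T, (∑ i, (c i * ζ i ^ k).re) ^ 2 =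
      ∑ i, ∑ j, ((∑ k ∈ Finset.range T, (c i * ζ i ^ k) * starRingEnd ℂ (c j * ζ j ^ k)).re +
        (∑ k ∈ Finset.range T, (c i * ζ i ^ k) * (c j * ζ j ^ k)).re) / 2 := by
    simp_rw [sq, Finset.sum_mul_sum, hre]
    rw [Finset.sum_comm]
    refine Finset.sum_congr rfl fun i _ => ?_
    rw [Finset.sum_comm]
    refine Finset.sum_congr rfl fun j _ => ?_
    rw [← Finset.sum_div, Finset.sum_add_distrib, Complex.re_sum, Complex.re_sum]
  rw [h3, Finset.mul_sum]
  refine Finset.sum_le_sum fun i _ => ?_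
  have h4 : (T : ℝ) / 2 * Complex.normSq (c i) =
      ∑ j, (if i = j then (T : ℝ) * Complex.normSq (c i) else 0) / 2 := by
    rw [← Finset.sum_div, Finset.sum_ite_eq]; simp; ring
  rw [h4]
  refine Finset.sum_le_sum fun j _ => ?_
  rw [h1]
  have h5 : (if i = j then (T : ℂ) * Complex.normSq (c i) else 0).re =
      if i = j then (T : ℝ) * Complex.normSq (c i) else 0 := by
    split_ifs <;> simp
  rw [h5]
  linarith [h2 i j]

/-! ### The root of unity attached to a grid frequency -/

/-- `e^(2πjf)`. -/
noncomputable def unitRoot (f : ℝ) : ℂ := Complex.exp (2 * Real.pi * Complex.I * f)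

theorem unitRoot_eq (f : ℝ) : unitRoot f = Complex.exp ((2 * Real.pi * f : ℝ) * Complex.I) := by
  rw [unitRoot]; congr 1; push_cast; ring

theorem norm_unitRoot (f : ℝ) : ‖unitRoot f‖ = 1 := by
  rw [unitRoot_eq, Complex.norm_exp_ofReal_mul_I]

theorem unitRoot_pow_re (f : ℝ) (k : ℕ) : (unitRoot f ^ k).re = Real.cos (2 * Real.pi * f * k) := by
  rw [unitRoot_eq, ← Complex.exp_nat_mul, ← Complex.exp_ofReal_mul_I_re]
  congr 2; push_cast; ring

theorem unitRoot_pow_eq_one {T : ℕ} (hT : 0 < T) {f : ℝ} (hf : f ∈ freqGrid T) :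
    unitRoot f ^ T = 1 := by
  obtain ⟨m, -, rfl⟩ := hf
  have hT' : (T : ℂ) ≠ 0 := by exact_mod_cast hT.ne'
  rw [unitRoot, ← Complex.exp_nat_mul, Complex.exp_eq_one_iff]
  exact ⟨m, by push_cast; field_simp⟩

theorem unitRoot_eq_one_iff {f : ℝ} : unitRoot f = 1 ↔ ∃ n : ℤ, f = n := by
  have h : (2 * Real.pi * Complex.I : ℂ) ≠ 0 := Complex.two_pi_I_ne_zero
  rw [unitRoot, Complex.exp_eq_one_iff]
  refine exists_congr fun n => ?_
  rw [mul_comm (n : ℂ), mul_right_inj' h]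
  norm_cast

theorem unitRoot_add (f g : ℝ) : unitRoot (f + g) = unitRoot f * unitRoot g := by
  rw [unitRoot, unitRoot, unitRoot, ← Complex.exp_add]; congr 1; push_cast; ring

theorem unitRoot_sub (f g : ℝ) : unitRoot (f - g) = unitRoot f * (unitRoot g)⁻¹ := by
  rw [unitRoot, unitRoot, unitRoot, ← Complex.exp_neg, ← Complex.exp_add]; congr 1; push_cast; ring

theorem freqGrid_bounds {T : ℕ} {f : ℝ} (hf : f ∈ freqGrid T) : 0 ≤ f ∧ f < 1 := by
  obtain ⟨m, hm, rfl⟩ := hf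
  have hT : (0 : ℝ) < T := by exact_mod_cast (Nat.zero_le m).trans_lt hm
  exact ⟨by positivity, (div_lt_one hT).2 (by exact_mod_cast hm)⟩

theorem unitRoot_injOn_freqGrid {T : ℕ} {f g : ℝ} (hf : f ∈ freqGrid T) (hg : g ∈ freqGrid T)
    (h : unitRoot f = unitRoot g) : f = g := by
  have hg0 : unitRoot g ≠ 0 := Complex.exp_ne_zero _
  have h1 : unitRoot (f - g) = 1 := by rw [unitRoot_sub, h, mul_inv_cancel₀ hg0]
  obtain ⟨n, hn⟩ := unitRoot_eq_one_iff.1 h1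
  have h2 := freqGrid_bounds hf
  have h3 := freqGrid_bounds hg
  have h4 : (n : ℝ) < 1 := by linarith
  have h5 : (-1 : ℝ) < n := by linarith
  have h6 : n < 1 := by exact_mod_cast h4
  have h7 : -1 < n := by exact_mod_cast h5
  have : n = 0 := by omega
  rw [this] at hn
  push_cast at hn
  linarith

theorem add_eq_zero_or_one_of_unitRoot {T : ℕ} {f g : ℝ} (hf : f ∈ freqGrid T)
    (hg : g ∈ freqGrid T) (h : unitRoot f * unitRoot g = 1) : f = g ∨ f + g = 1 := by
  rw [← unitRoot_add, unitRoot_eq_one_iff] at h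
  obtain ⟨n, hn⟩ := h
  have h2 := freqGrid_bounds hf
  have h3 := freqGrid_bounds hg
  have h4 : (n : ℝ) < 2 := by linarith
  have h5 : (-1 : ℝ) < n := by linarith
  have h6 : n < 2 := by exact_mod_cast h4
  have h7 : -1 < n := by exact_mod_cast h5
  rcases (by omega : n = 0 ∨ n = 1) with rfl | rfl
  -- Two nonnegative frequencies with sum 0 both vanish.
  · left; push_cast at hn; linarith
  · right; exact_mod_cast hn

/-! ### Steady-state response to the exploration input -/

section Response

variable {nx nu L : ℕ}

/-- `V(f) b`. -/
noncomputable def response (A : Matrix (Fin nx) (Fin nx) ℝ) (B : Matrix (Fin nx) (Fin nu) ℝ)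
    (f : ℝ) (b : Fin nu → ℝ) : Fin nx ⊕ Fin nu → ℂ :=
  transferMat A B f *ᵥ fun j => (b j : ℂ)

theorem response_inr (A : Matrix (Fin nx) (Fin nx) ℝ) (B : Matrix (Fin nx) (Fin nu) ℝ)
    (f : ℝ) (b : Fin nu → ℝ) (j : Fin nu) : response A B f b (Sum.inr j) = b j := by
  simp [response, transferMat, Matrix.fromRows_mulVec]

theorem response_inl (A : Matrix (Fin nx) (Fin nx) ℝ) (B : Matrix (Fin nx) (Fin nu) ℝ)
    (f : ℝ) (b : Fin nu → ℝ) :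
    (fun i => response A B f b (Sum.inl i)) =
      (unitRoot f • (1 : Matrix (Fin nx) (Fin nx) ℂ) - A.map ((↑) : ℝ → ℂ))⁻¹ *ᵥ
        fun i => ((B *ᵥ b) i : ℂ) := by
  funext i
  have : (fun i => ((B *ᵥ b) i : ℂ)) = B.map ((↑) : ℝ → ℂ) *ᵥ fun j => (b j : ℂ) := by
    funext i; simp [Matrix.mulVec, dotProduct]
  rw [this, Matrix.mulVec_mulVec]
  simp [response, transferMat, Matrix.fromRows_mulVec, unitRoot]

theorem isUnit_det_resolvent {A : Matrix (Fin nx) (Fin nx) ℝ} (hstable : SchurStable A) (f : ℝ) :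
    IsUnit (unitRoot f • (1 : Matrix (Fin nx) (Fin nx) ℂ) - A.map ((↑) : ℝ → ℂ)).det := by
  rw [← Matrix.isUnit_iff_isUnit_det]
  by_contra h
  have h2 : unitRoot f ∈ spectrum ℂ (A.map ((↑) : ℝ → ℂ)) := by
    rw [spectrum.mem_iff, Algebra.algebraMap_eq_smul_one]
    exact h
  have := hstable _ h2
  rw [norm_unitRoot] at this
  exact lt_irrefl _ this

theorem unitRoot_mul_response_inl {A : Matrix (Fin nx) (Fin nx) ℝ} (hstable : SchurStable A)
    (B : Matrix (Fin nx) (Fin nu) ℝ) (f : ℝ) (b : Fin nu → ℝ) (i : Fin nx) :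
    unitRoot f * response A B f b (Sum.inl i) =
      (∑ j, (A i j : ℂ) * response A B f b (Sum.inl j)) + ((B *ᵥ b) i : ℂ) := by
  have h := congrArg (fun v => (unitRoot f • (1 : Matrix (Fin nx) (Fin nx) ℂ)
    - A.map ((↑) : ℝ → ℂ)) *ᵥ v) (response_inl A B f b)
  simp only [Matrix.mulVec_mulVec, Matrix.mul_nonsing_inv _ (isUnit_det_resolvent hstable f),
    Matrix.one_mulVec, Matrix.sub_mulVec, Matrix.smul_mulVec] at h
  have h2 := congrFun h i
  simp only [Pi.sub_apply, Pi.smul_apply, smul_eq_mul, Matrix.mulVec, dotProduct,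
    Matrix.map_apply] at h2
  rw [← sub_eq_iff_eq_add', h2]
  simp [Matrix.mulVec, dotProduct]

/-- `A`, `B` and `b` are real, so conjugating the transfer function amounts to conjugating the point
on the unit circle. -/
theorem response_conj {A : Matrix (Fin nx) (Fin nx) ℝ} (B : Matrix (Fin nx) (Fin nu) ℝ)
    {f g : ℝ} (h : unitRoot f * unitRoot g = 1) (b : Fin nu → ℝ) (a : Fin nx ⊕ Fin nu) :
    response A B g b a = starRingEnd ℂ (response A B f b a) := by
  have hg : unitRoot g = starRingEnd ℂ (unitRoot f) := by
    rw [← Complex.inv_eq_conj (norm_unitRoot f)]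
    exact eq_inv_of_mul_eq_one_right h
  rcases a with i | j
  · have h1 := congrFun (response_inl A B g b) i
    have h2 := congrFun (response_inl A B f b) i
    rw [h1, h2]
    have hM : unitRoot g • (1 : Matrix (Fin nx) (Fin nx) ℂ) - A.map ((↑) : ℝ → ℂ) =
        (unitRoot f • (1 : Matrix (Fin nx) (Fin nx) ℂ) - A.map ((↑) : ℝ → ℂ)).map
          (starRingEnd ℂ) := by
      ext p q
      rw [hg]
      by_cases hpq : p = q <;> simp [hpq]
    have hinv : ∀ M : Matrix (Fin nx) (Fin nx) ℂ,
        (M.map (starRingEnd ℂ))⁻¹ = M⁻¹.map (starRingEnd ℂ) := by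
      intro M
      have h3 : ∀ N : Matrix (Fin nx) (Fin nx) ℂ, N.map (starRingEnd ℂ) = Nᴴᵀ := fun N => by
        ext; simp
      rw [h3, h3, Matrix.conjTranspose_nonsing_inv, Matrix.transpose_nonsing_inv]
    rw [hM, hinv]
    simp [Matrix.mulVec, dotProduct]
  · simp [response_inr]

/-- The steady-state regressor `∑ i, Re (V(ω_i) ū_i e^(2πjω_i k))`. -/
noncomputable def steady (A : Matrix (Fin nx) (Fin nx) ℝ) (B : Matrix (Fin nx) (Fin nu) ℝ)
    (freq : Fin L → ℝ) (ubar : Fin L → Fin nu → ℝ) (k : ℕ) (a : Fin nx ⊕ Fin nu) : ℝ :=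
  ∑ i, (response A B (freq i) (ubar i) a * unitRoot (freq i) ^ k).re

/-- The steady state. -/
noncomputable def steadyState (A : Matrix (Fin nx) (Fin nx) ℝ) (B : Matrix (Fin nx) (Fin nu) ℝ)
    (freq : Fin L → ℝ) (ubar : Fin L → Fin nu → ℝ) (k : ℕ) (i : Fin nx) : ℝ :=
  steady A B freq ubar k (Sum.inl i)

variable (A : Matrix (Fin nx) (Fin nx) ℝ) (B : Matrix (Fin nx) (Fin nu) ℝ)
  (freq : Fin L → ℝ) (ubar : Fin L → Fin nu → ℝ)

theorem steady_inr (k : ℕ) (j : Fin nu) :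
    steady A B freq ubar k (Sum.inr j) = exploreInput freq ubar k j := by
  simp only [steady, response_inr, exploreInput, Finset.sum_apply, Pi.smul_apply, smul_eq_mul,
    Complex.re_ofReal_mul, unitRoot_pow_re]
  exact Finset.sum_congr rfl fun i _ => mul_comm _ _

theorem steadyState_succ (hstable : SchurStable A) (k : ℕ) :
    steadyState A B freq ubar (k + 1) =
      A *ᵥ steadyState A B freq ubar k + B *ᵥ exploreInput freq ubar k := by
  funext i
  have h1 : ∀ l, (response A B (freq l) (ubar l) (Sum.inl i) * unitRoot (freq l) ^ (k + 1)).re =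
      ∑ j, A i j * (response A B (freq l) (ubar l) (Sum.inl j) * unitRoot (freq l) ^ k).re +
        (B *ᵥ ubar l) i * Real.cos (2 * Real.pi * freq l * k) := by
    intro l
    rw [pow_succ', ← mul_assoc, mul_comm (response _ _ _ _ _), unitRoot_mul_response_inl hstable,
      add_mul, Complex.add_re, Complex.re_ofReal_mul, unitRoot_pow_re, Finset.sum_mul,
      Complex.re_sum]
    simp_rw [mul_assoc, Complex.re_ofReal_mul]
  simp only [steadyState, steady, h1, Pi.add_apply, Finset.sum_add_distrib]
  congr 1
  · rw [Finset.sum_comm]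
    simp only [Matrix.mulVec, dotProduct, steadyState, steady, Finset.mul_sum]
  · simp only [exploreInput, Matrix.mulVec_sum, Matrix.mulVec_smul, Finset.sum_apply,
      Pi.smul_apply, smul_eq_mul]
    exact Finset.sum_congr rfl fun i _ => mul_comm _ _

theorem steadyState_mul_period {T : ℕ} (hT : 0 < T) (hfreq : ∀ i, freq i ∈ freqGrid T) (N : ℕ) :
    steadyState A B freq ubar (N * T) = steadyState A B freq ubar 0 := by
  funext i
  simp [steadyState, steady, mul_comm N T, pow_mul, unitRoot_pow_eq_one hT (hfreq _)]

/-- Superposition: the last term corrects the initial value, since the true state starts at 0 and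
the periodic solution need not. -/
theorem state_eq_steadyState (hstable : SchurStable A) (w : ℕ → Fin nx → ℝ) (k : ℕ) :
    state A B (exploreInput freq ubar) w k = steadyState A B freq ubar k
      + state A B 0 w k - (A ^ k) *ᵥ steadyState A B freq ubar 0 := by
  induction k with
  | zero => simp [state]
  | succ k ih =>
    rw [state, ih, state, steadyState_succ A B freq ubar hstable, Matrix.mulVec_sub,
      Matrix.mulVec_add, pow_succ', ← Matrix.mulVec_mulVec]
    simp only [Pi.zero_apply, Matrix.mulVec_zero]
    abel

/-! ### Energy of the input, of the transient and of the noise response -/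

theorem dotProduct_exploreInput_le (k : ℕ) :
    exploreInput freq ubar k ⬝ᵥ exploreInput freq ubar k ≤ L * ∑ i, euclNorm (ubar i) ^ 2 := by
  have h : ∀ j, exploreInput freq ubar k j * exploreInput freq ubar k j ≤
      L * ∑ i, ubar i j * ubar i j := by
    intro j
    rw [← sq]
    have h1 := sq_sum_le_card_mul_sum_sq (s := Finset.univ)
      (f := fun i => Real.cos (2 * Real.pi * freq i * k) * ubar i j)
    simp only [exploreInput, Finset.sum_apply, Pi.smul_apply, smul_eq_mul]
    refine h1.trans ?_
    rw [Finset.card_univ, Fintype.card_fin]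
    refine mul_le_mul_of_nonneg_left (Finset.sum_le_sum fun i _ => ?_) L.cast_nonneg
    rw [mul_pow, ← sq]
    exact mul_le_of_le_one_left (sq_nonneg _) (Real.cos_sq_le_one _)
  refine (Finset.sum_le_sum fun j _ => h j).trans_eq ?_
  rw [← Finset.mul_sum, Finset.sum_comm]
  simp_rw [euclNorm_sq]
  rfl

theorem euclNorm_exploreInput_le {γe : ℝ} (hγe : 0 ≤ γe)
    (henergy : ∑ i, euclNorm (ubar i) ^ 2 ≤ γe ^ 2) (k : ℕ) :
    euclNorm (exploreInput freq ubar k) ≤ Real.sqrt L * γe := by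
  rw [← Real.sqrt_sq hγe, ← Real.sqrt_mul L.cast_nonneg]
  exact Real.sqrt_le_sqrt ((dotProduct_exploreInput_le freq ubar k).trans
    (mul_le_mul_of_nonneg_left henergy L.cast_nonneg))

variable {A B freq ubar}

/-- The steady state is periodic, so its value at time 0 is also its value at time `N T`. Unrolling
the recursion from there gives a geometric series in the past inputs plus `A^(k + N T) x_ss(0)`,
which vanishes as `N → ∞`. -/
theorem euclNorm_pow_mulVec_steadyState_le {T : ℕ} (hT : 0 < T) (hstable : SchurStable A)
    {C ρ : ℝ} (hC : 1 ≤ C) (hρ0 : 0 < ρ) (hρ1 : ρ < 1)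
    (hdecay : ∀ k : ℕ, specNorm (A ^ k) ≤ C * ρ ^ k) (hfreq : ∀ i, freq i ∈ freqGrid T)
    {M : ℝ} (hM : ∀ k, euclNorm (exploreInput freq ubar k) ≤ M) (k : ℕ) :
    euclNorm ((A ^ k) *ᵥ steadyState A B freq ubar 0) ≤
      C * ρ ^ k / (1 - ρ) * (specNorm B * M) := by
  have h1ρ : 0 < 1 - ρ := by linarith
  have hM0 : 0 ≤ M := (euclNorm_nonneg _).trans (hM 0)
  have hstep : ∀ n k, euclNorm ((A ^ k) *ᵥ steadyState A B freq ubar n) ≤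
      euclNorm ((A ^ (k + n)) *ᵥ steadyState A B freq ubar 0) +
        C * ρ ^ k / (1 - ρ) * (specNorm B * M) := by
    intro n
    induction n with
    | zero =>
      intro k
      have := specNorm_nonneg B
      have : 0 ≤ C * ρ ^ k / (1 - ρ) * (specNorm B * M) := by positivity
      simpa using this
    | succ n ih =>
      intro k
      rw [steadyState_succ A B freq ubar hstable, Matrix.mulVec_add, Matrix.mulVec_mulVec,
        ← pow_succ]
      refine (euclNorm_add_le _ _).trans ?_
      have h2 : euclNorm ((A ^ k) *ᵥ (B *ᵥ exploreInput freq ubar n)) ≤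
          C * ρ ^ k * (specNorm B * M) := by
        refine (euclNorm_mulVec_le _ _).trans ?_
        refine mul_le_mul (hdecay k) ?_ (euclNorm_nonneg _) (by positivity)
        exact (euclNorm_mulVec_le _ _).trans
          (mul_le_mul_of_nonneg_left (hM n) (specNorm_nonneg B))
      have h3 := ih (k + 1)
      rw [show k + 1 + n = k + (n + 1) by ring] at h3
      refine (add_le_add h3 h2).trans_eq ?_
      field_simp
      ring
  have hlim : Filter.Tendsto (fun N : ℕ => C * ρ ^ N * euclNorm (steadyState A B freq ubar 0) +
      C * ρ ^ k / (1 - ρ) * (specNorm B * M)) Filter.atTop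
      (nhds (C * 0 * euclNorm (steadyState A B freq ubar 0) +
        C * ρ ^ k / (1 - ρ) * (specNorm B * M))) :=
    (((tendsto_pow_atTop_nhds_zero_of_lt_one hρ0.le hρ1).const_mul C).mul_const _).add_const _
  rw [mul_zero, zero_mul, zero_add] at hlim
  refine ge_of_tendsto' hlim fun N => ?_
  have h4 := hstep (N * T) k
  rw [steadyState_mul_period A B freq ubar hT hfreq] at h4
  refine h4.trans (add_le_add_left ((euclNorm_mulVec_le _ _).trans
    (mul_le_mul_of_nonneg_right ((hdecay _).trans ?_) (euclNorm_nonneg _))) _)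
  refine mul_le_mul_of_nonneg_left (pow_le_pow_of_le_one hρ0.le hρ1.le ?_) (by linarith)
  exact (Nat.le_mul_of_pos_right N hT).trans (Nat.le_add_left _ _)

theorem sum_sq_transient_le {T : ℕ} (hT : 0 < T) (hstable : SchurStable A)
    {C ρ : ℝ} (hC : 1 ≤ C) (hρ0 : 0 < ρ) (hρ1 : ρ < 1)
    (hdecay : ∀ k : ℕ, specNorm (A ^ k) ≤ C * ρ ^ k) (hfreq : ∀ i, freq i ∈ freqGrid T)
    {γe : ℝ} (hγe : 0 ≤ γe) (henergy : ∑ i, euclNorm (ubar i) ^ 2 ≤ γe ^ 2) (z : Fin nx → ℝ) :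
    ∑ k ∈ Finset.range T, (z ⬝ᵥ ((A ^ k) *ᵥ steadyState A B freq ubar 0)) ^ 2 ≤
      L * γe ^ 2 * (specNorm B * C / (1 - ρ) ^ 2) ^ 2 * (z ⬝ᵥ z) := by
  have h1ρ : 0 < 1 - ρ := by linarith
  have hB := specNorm_nonneg B
  have hz := dotProduct_self_nonneg' z
  set K := L * γe ^ 2 * (specNorm B * C / (1 - ρ)) ^ 2 * (z ⬝ᵥ z) with hK
  have hK0 : 0 ≤ K := by positivity
  have h1 : ∀ k, (z ⬝ᵥ ((A ^ k) *ᵥ steadyState A B freq ubar 0)) ^ 2 ≤ K * ρ ^ k := by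
    intro k
    have h2 := euclNorm_pow_mulVec_steadyState_le (B := B) hT hstable hC hρ0 hρ1 hdecay hfreq
      (euclNorm_exploreInput_le freq ubar hγe henergy) k
    have h3 := pow_le_pow_left₀ (euclNorm_nonneg _) h2 2
    rw [euclNorm_sq] at h3
    refine (sq_dotProduct_le _ _).trans ((mul_le_mul_of_nonneg_left h3 hz).trans ?_)
    have h4 : (z ⬝ᵥ z) * (C * ρ ^ k / (1 - ρ) * (specNorm B * (Real.sqrt L * γe))) ^ 2 =
        K * (ρ ^ k * ρ ^ k) := by
      rw [hK]
      have : Real.sqrt L ^ 2 = L := Real.sq_sqrt L.cast_nonneg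
      simp only [mul_pow, div_pow, this]
      ring
    rw [h4]
    refine mul_le_mul_of_nonneg_left ?_ hK0
    exact mul_le_of_le_one_left (by positivity) (pow_le_one₀ hρ0.le hρ1.le)
  refine (Finset.sum_le_sum fun k _ => h1 k).trans ?_
  rw [← Finset.mul_sum]
  -- The series is at most `1/(1-ρ)`; a further factor `1/(1-ρ)` is given away to match the form of
  -- `Γ_u`.
  have h5 : ∑ k ∈ Finset.range T, ρ ^ k ≤ 1 / (1 - ρ) ^ 2 := by
    rw [geom_sum_eq hρ1.ne, ← neg_div_neg_eq, neg_sub, neg_sub, div_le_div_iff₀ h1ρ (by positivity)]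
    have : 0 ≤ ρ ^ T := by positivity
    nlinarith [mul_nonneg h1ρ.le this, mul_pos h1ρ hρ0]
  refine (mul_le_mul_of_nonneg_left h5 hK0).trans_eq ?_
  rw [hK]
  field_simp

theorem state_zero_input (A : Matrix (Fin nx) (Fin nx) ℝ) (B : Matrix (Fin nx) (Fin nu) ℝ)
    (w : ℕ → Fin nx → ℝ) (k : ℕ) :
    state A B 0 w k = ∑ l ∈ Finset.range k, (A ^ (k - 1 - l)) *ᵥ w l := by
  induction k with
  | zero => simp [state]
  | succ k ih =>
    rw [state, ih, Finset.sum_range_succ, Matrix.mulVec_sum]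
    simp only [Pi.zero_apply, Matrix.mulVec_zero, add_zero, Nat.add_sub_cancel, Nat.sub_self,
      pow_zero, Matrix.one_mulVec]
    congr 1
    refine Finset.sum_congr rfl fun l hl => ?_
    rw [Matrix.mulVec_mulVec, ← pow_succ']
    congr 3
    have := Finset.mem_range.1 hl
    omega

theorem Aw_mulVec_stackedNoise (T : ℕ) (A : Matrix (Fin nx) (Fin nx) ℝ)
    (B : Matrix (Fin nx) (Fin nu) ℝ) (w : ℕ → Fin nx → ℝ) (p : Fin T × Fin nx) :
    (Aw T A *ᵥ stackedNoise T w) p = state A B 0 w (p.1 + 1) p.2 := by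
  rw [state_zero_input, Finset.sum_apply]
  simp only [Matrix.mulVec, dotProduct, Fintype.sum_prod_type, Aw, Matrix.of_apply, stackedNoise,
    Nat.add_sub_cancel]
  rw [Fin.sum_univ_eq_sum_range (fun l => ∑ j, (if l ≤ (p.1 : ℕ) then
    (A ^ ((p.1 : ℕ) - l)) p.2 j else 0) * w l j) T]
  symm
  refine Finset.sum_subset_zero_on_sdiff ?_ ?_ ?_
  · intro l hl
    have := p.1.2
    simp only [Finset.mem_range] at hl ⊢
    omega
  · intro l hl
    simp only [Finset.mem_sdiff, Finset.mem_range] at hl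
    refine Finset.sum_eq_zero fun j _ => ?_
    rw [if_neg (by omega), zero_mul]
  · intro l hl
    refine Finset.sum_congr rfl fun j _ => ?_
    rw [if_pos (by simpa [Nat.lt_succ_iff] using hl)]

theorem sum_sq_noise_response_le (T : ℕ) (A : Matrix (Fin nx) (Fin nx) ℝ)
    (B : Matrix (Fin nx) (Fin nu) ℝ) (w : ℕ → Fin nx → ℝ) (z : Fin nx → ℝ) :
    ∑ k ∈ Finset.range T, (z ⬝ᵥ state A B 0 w k) ^ 2 ≤
      specNorm (Aw T A) ^ 2 * (stackedNoise T w ⬝ᵥ stackedNoise T w) * (z ⬝ᵥ z) := by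
  have h1 : ∑ k ∈ Finset.range T, (state A B 0 w k ⬝ᵥ state A B 0 w k) ≤
      specNorm (Aw T A) ^ 2 * (stackedNoise T w ⬝ᵥ stackedNoise T w) := by
    -- `A_w` produces the states at times 1 to `T`, whereas the regressor contains times 0 to `T -
    -- 1`. Time 0 contributes nothing and time `T` may be added.
    calc _ ≤ ∑ k ∈ Finset.range (T + 1), (state A B 0 w k ⬝ᵥ state A B 0 w k) := by
          rw [Finset.sum_range_succ]
          exact le_add_of_nonneg_right (dotProduct_self_nonneg' _)
      _ = ∑ k ∈ Finset.range T, (state A B 0 w (k + 1) ⬝ᵥ state A B 0 w (k + 1)) := by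
          rw [Finset.sum_range_succ']; simp [state]
      _ = euclNorm (Aw T A *ᵥ stackedNoise T w) ^ 2 := by
          rw [euclNorm_sq, dotProduct, Fintype.sum_prod_type, Finset.sum_range]
          simp_rw [Aw_mulVec_stackedNoise T A B w]
          rfl
      _ ≤ _ := by
          rw [← euclNorm_sq, ← mul_pow]
          exact pow_le_pow_left₀ (euclNorm_nonneg _) (euclNorm_mulVec_le _ _) 2
  refine (Finset.sum_le_sum fun k _ => sq_dotProduct_le _ _).trans ?_
  rw [← Finset.mul_sum, mul_comm]
  exact mul_le_mul_of_nonneg_right h1 (dotProduct_self_nonneg' z)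

end Response

/-! ### Lower bound on the regressor Gram matrix -/

section Excitation

variable {nx nu L T : ℕ} {A : Matrix (Fin nx) (Fin nx) ℝ} {B : Matrix (Fin nx) (Fin nu) ℝ}
  {freq : Fin L → ℝ} {ubar : Fin L → Fin nu → ℝ}

theorem dotProduct_gram_mulVec {m n : Type*} [Fintype m] [Fintype n] (M : Matrix m n ℝ)
    (z : m → ℝ) : z ⬝ᵥ ((M * Mᵀ) *ᵥ z) = ∑ k, (∑ a, z a * M a k) ^ 2 := by
  rw [← Matrix.mulVec_mulVec, Matrix.dotProduct_mulVec, ← Matrix.mulVec_transpose, dotProduct]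
  simp only [Matrix.mulVec, dotProduct, Matrix.transpose_apply, sq, mul_comm]

theorem sum_sq_steady_ge (hT : 0 < T) (hfreq : ∀ i, freq i ∈ freqGrid T)
    (hinj : Function.Injective freq) (hmirror : ∀ i j, freq i + freq j = 1 → ubar i = ubar j)
    (z : Fin nx ⊕ Fin nu → ℝ) :
    (T : ℝ) / 2 * ∑ i, Complex.normSq (∑ a, (z a : ℂ) * response A B (freq i) (ubar i) a) ≤
      ∑ k ∈ Finset.range T, (∑ a, z a * steady A B freq ubar k a) ^ 2 := by
  have h := half_sum_normSq_le_sum_sq (T := T) (ζ := fun i => unitRoot (freq i))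
    (c := fun i => ∑ a, (z a : ℂ) * response A B (freq i) (ubar i) a)
    (fun i => unitRoot_pow_eq_one hT (hfreq i)) (fun i => norm_unitRoot _)
    (fun i j hij => hinj (unitRoot_injOn_freqGrid (hfreq i) (hfreq j) hij)) ?_
  · refine h.trans_eq (Finset.sum_congr rfl fun k _ => ?_)
    congr 1
    simp_rw [steady, Finset.mul_sum]
    rw [Finset.sum_comm]
    refine Finset.sum_congr rfl fun i _ => ?_
    rw [Finset.sum_mul, Complex.re_sum]
    refine Finset.sum_congr rfl fun a _ => ?_
    rw [mul_assoc, Complex.re_ofReal_mul]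
  · intro i j hij
    have hu : ubar j = ubar i := by
      rcases add_eq_zero_or_one_of_unitRoot (hfreq i) (hfreq j) hij with h | h
      · rw [hinj h]
      · exact (hmirror i j h).symm
    rw [map_sum]
    refine Finset.sum_congr rfl fun a _ => ?_
    rw [map_mul, Complex.conj_ofReal, hu, response_conj B hij]

/-- Young's inequality with weight `ε` separates `a`; then `(n - t)²` is split with the unequal
weights 4/3 and 4. The 4/3 cancels the 3/4 of the noise energy bound, and the 4 is the one in `Γ_u`.
-/
theorem sq_add_sub_ge {ε : ℝ} (hε0 : 0 < ε) (hε1 : ε < 1) (a n t : ℝ) :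
    (1 - ε) * a ^ 2 - (1 - ε) / ε * (4 / 3 * n ^ 2 + 4 * t ^ 2) ≤ (a + n - t) ^ 2 := by
  have h1 : (n - t) ^ 2 ≤ 4 / 3 * n ^ 2 + 4 * t ^ 2 := by nlinarith [sq_nonneg (n + 3 * t)]
  have h2 : 0 ≤ (1 - ε) / ε := div_nonneg (by linarith) hε0.le
  have h3 := mul_le_mul_of_nonneg_left h1 h2
  have h4 : (a + n - t) ^ 2 - (1 - ε) * a ^ 2 + (1 - ε) / ε * (n - t) ^ 2 =
      (ε * a + (n - t)) ^ 2 / ε := by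
    field_simp; ring
  have h5 : 0 ≤ (ε * a + (n - t)) ^ 2 / ε := by positivity
  linarith

/-- Sums the pointwise Young bound over `k`, then uses the energies of the three parts. Transient
and noise act only on the state block, so the state part `zx` of `z` suffices for them. -/
theorem gram_ge (hT : 0 < T) (hstable : SchurStable A)
    {C ρ : ℝ} (hC : 1 ≤ C) (hρ0 : 0 < ρ) (hρ1 : ρ < 1)
    (hdecay : ∀ k : ℕ, specNorm (A ^ k) ≤ C * ρ ^ k) (hfreq : ∀ i, freq i ∈ freqGrid T)
    (hinj : Function.Injective freq) (hmirror : ∀ i j, freq i + freq j = 1 → ubar i = ubar j)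
    {γe : ℝ} (hγe : 0 ≤ γe) (henergy : ∑ i, euclNorm (ubar i) ^ 2 ≤ γe ^ 2)
    {ε σ δ : ℝ} (hε0 : 0 < ε) (hε1 : ε < 1) {w : ℕ → Fin nx → ℝ}
    (hw : stackedNoise T w ⬝ᵥ stackedNoise T w ≤ 3 / 4 * gammaW nx T σ δ)
    (z : Fin nx ⊕ Fin nu → ℝ) :
    (1 - ε) * ((T : ℝ) / 2 * ∑ i, Complex.normSq
        (∑ a, (z a : ℂ) * response A B (freq i) (ubar i) a))
      - (1 - ε) / ε * (4 * L * γe ^ 2 * (specNorm B * C / (1 - ρ) ^ 2) ^ 2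
        + L * specNorm (Aw T A) ^ 2 * gammaW nx T σ δ) * (z ⬝ᵥ z) ≤
      z ⬝ᵥ ((dataRegressor A B T freq ubar w * (dataRegressor A B T freq ubar w)ᵀ) *ᵥ z) := by
  have h1ε : 0 < 1 - ε := by linarith
  have hγ : 0 ≤ gammaW nx T σ δ := by
    have := dotProduct_self_nonneg' (stackedNoise T w); linarith
  have hz := dotProduct_self_nonneg' z
  rw [dotProduct_gram_mulVec]
  -- `Γ_w` carries a factor `L`, which can be inserted for free only when `L ≥ 1`. For `L = 0` the
  -- lower bound is 0.
  rcases Nat.eq_zero_or_pos L with rfl | hL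
  · simp only [Finset.univ_eq_empty, Finset.sum_empty, Nat.cast_zero, mul_zero, zero_mul, add_zero,
      sub_zero]
    exact Finset.sum_nonneg fun k _ => sq_nonneg _
  have hL' : (1 : ℝ) ≤ L := by exact_mod_cast hL
  set zx : Fin nx → ℝ := fun i => z (Sum.inl i) with hzx
  have hzxle : zx ⬝ᵥ zx ≤ z ⬝ᵥ z := by
    simp only [dotProduct, Fintype.sum_sum_type]
    exact le_add_of_nonneg_right (Finset.sum_nonneg fun j _ => mul_self_nonneg _)
  have hΦ : ∀ k : Fin T, ∑ a, z a * dataRegressor A B T freq ubar w a k =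
      (∑ a, z a * steady A B freq ubar k a) + zx ⬝ᵥ state A B 0 w k
        - zx ⬝ᵥ ((A ^ (k : ℕ)) *ᵥ steadyState A B freq ubar 0) := by
    intro k
    simp only [dataRegressor, regressor, Matrix.of_apply, Fintype.sum_sum_type, Sum.elim_inl,
      Sum.elim_inr, steady_inr, state_eq_steadyState A B freq ubar hstable w]
    simp only [Pi.add_apply, Pi.sub_apply, mul_add, mul_sub, Finset.sum_add_distrib,
      Finset.sum_sub_distrib, steadyState, dotProduct, hzx]
    ring
  have h1 := Finset.sum_le_sum fun (k : Fin T) (_ : k ∈ Finset.univ) =>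
    sq_add_sub_ge hε0 hε1 (∑ a, z a * steady A B freq ubar k a) (zx ⬝ᵥ state A B 0 w k)
      (zx ⬝ᵥ ((A ^ (k : ℕ)) *ᵥ steadyState A B freq ubar 0))
  simp_rw [hΦ]
  refine le_trans ?_ h1
  rw [Finset.sum_sub_distrib, ← Finset.mul_sum, ← Finset.mul_sum, Finset.sum_add_distrib,
    ← Finset.mul_sum, ← Finset.mul_sum,
    Fin.sum_univ_eq_sum_range (fun k => (∑ a, z a * steady A B freq ubar k a) ^ 2) T,
    Fin.sum_univ_eq_sum_range (fun k => (zx ⬝ᵥ state A B 0 w k) ^ 2) T,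
    Fin.sum_univ_eq_sum_range (fun k => (zx ⬝ᵥ ((A ^ k) *ᵥ steadyState A B freq ubar 0)) ^ 2) T]
  have h2 := mul_le_mul_of_nonneg_left
    (sum_sq_steady_ge (A := A) (B := B) hT hfreq hinj hmirror z) h1ε.le
  have h3 := sum_sq_transient_le (B := B) hT hstable hC hρ0 hρ1 hdecay hfreq hγe henergy zx
  have h4 := sum_sq_noise_response_le T A B w zx
  have h5 : L * γe ^ 2 * (specNorm B * C / (1 - ρ) ^ 2) ^ 2 * (zx ⬝ᵥ zx) ≤
      L * γe ^ 2 * (specNorm B * C / (1 - ρ) ^ 2) ^ 2 * (z ⬝ᵥ z) :=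
    mul_le_mul_of_nonneg_left hzxle (by positivity)
  have h6 : specNorm (Aw T A) ^ 2 * (stackedNoise T w ⬝ᵥ stackedNoise T w) * (zx ⬝ᵥ zx) ≤
      specNorm (Aw T A) ^ 2 * (3 / 4 * gammaW nx T σ δ) * (z ⬝ᵥ z) :=
    mul_le_mul (mul_le_mul_of_nonneg_left hw (sq_nonneg _)) hzxle (dotProduct_self_nonneg' _)
      (by positivity)
  have h7 : specNorm (Aw T A) ^ 2 * gammaW nx T σ δ * (z ⬝ᵥ z) ≤
      L * (specNorm (Aw T A) ^ 2 * gammaW nx T σ δ * (z ⬝ᵥ z)) :=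
    le_mul_of_one_le_left (by positivity) hL'
  have h8 : 0 ≤ (1 - ε) / ε := by positivity
  have h9 : 4 / 3 * ∑ k ∈ Finset.range T, (zx ⬝ᵥ state A B 0 w k) ^ 2 +
      4 * ∑ k ∈ Finset.range T, (zx ⬝ᵥ ((A ^ k) *ᵥ steadyState A B freq ubar 0)) ^ 2 ≤
      (4 * L * γe ^ 2 * (specNorm B * C / (1 - ρ) ^ 2) ^ 2
        + L * specNorm (Aw T A) ^ 2 * gammaW nx T σ δ) * (z ⬝ᵥ z) := by
    linarith
  have h10 := mul_le_mul_of_nonneg_left h9 h8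
  rw [← mul_assoc] at h10
  linarith

theorem quadratic_conj_gram {m p l : Type*} [Fintype m] [Fintype p] [Fintype l]
    (V : Matrix m p ℂ) (M : Matrix p l ℝ) {z : m → ℂ} (hz : star z = z) :
    (z ⬝ᵥ ((V * (M * Mᵀ).map ((↑) : ℝ → ℂ) * Vᴴ) *ᵥ z)).re =
      ∑ j, Complex.normSq ((z ᵥ* (V * M.map ((↑) : ℝ → ℂ))) j) := by
  set K := V * M.map ((↑) : ℝ → ℂ) with hK
  have h1 : V * (M * Mᵀ).map ((↑) : ℝ → ℂ) * Vᴴ = K * Kᴴ := by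
    have h2 : (M * Mᵀ).map ((↑) : ℝ → ℂ) = M.map ((↑) : ℝ → ℂ) * (M.map ((↑) : ℝ → ℂ))ᴴ := by
      ext i j
      simp [Matrix.mul_apply]
    rw [h2, hK, Matrix.conjTranspose_mul]
    simp only [Matrix.mul_assoc]
  have h3 : Kᴴ *ᵥ z = star (z ᵥ* K) := by rw [Matrix.star_vecMul, hz]
  rw [h1, ← Matrix.mulVec_mulVec, Matrix.dotProduct_mulVec, h3, dotProduct, Complex.re_sum]
  refine Finset.sum_congr rfl fun j _ => ?_
  rw [Pi.star_apply, Complex.star_def, Complex.mul_conj, Complex.ofReal_re]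

theorem vecMul_Vtr_mul_Ue (z : Fin nx ⊕ Fin nu → ℂ) (l : Fin L) :
    (z ᵥ* (Vtr A B freq * (Ue ubar).map ((↑) : ℝ → ℂ))) l =
      ∑ a, z a * response A B (freq l) (ubar l) a := by
  simp only [Matrix.vecMul, dotProduct]
  refine Finset.sum_congr rfl fun a _ => ?_
  congr 1
  simp only [Matrix.mul_apply, Fintype.sum_prod_type, Vtr, Ue, Matrix.of_apply, Matrix.map_apply,
    response, Matrix.mulVec, dotProduct]
  rw [Finset.sum_eq_single l (fun i _ hi => by simp [hi]) (by simp)]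
  simp

/-- The complex matrix inequality is needed only on real vectors, where its first term is bounded
above by the steady-state excitation. -/
theorem lmi_quadratic {w : ℕ → Fin nx → ℝ} {Utilde : Matrix (Fin L × Fin nu) (Fin L) ℝ}
    {C ρ γe σ δ ε lam θbar : ℝ} (hε1 : ε < 1)
    {Ddes : Matrix (Fin nx ⊕ Fin nu) (Fin nx ⊕ Fin nu) ℝ}
    (hLMI : LMIHolds A B T freq ubar Utilde C ρ γe σ δ ε lam θbar Ddes w)
    (z : Fin nx ⊕ Fin nu → ℝ) :
    1 / (T : ℝ) * (2 * C1 nx nu σ δ lam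
        + 8 * σ ^ 2 * Real.log (Dbar lam (dataRegressor A B T freq ubar w)).det
        + 2 * lam * θbar ^ 2) * (z ⬝ᵥ (Ddes *ᵥ z)) ≤
      (1 - ε) * ∑ i, Complex.normSq (∑ a, (z a : ℂ) * response A B (freq i) (ubar i) a)
      - 2 * (1 - ε) / ε * (4 * L * γe ^ 2 / T * (specNorm B * C / (1 - ρ) ^ 2) ^ 2) * (z ⬝ᵥ z)
      + lam / T * (z ⬝ᵥ z)
      - 2 * (1 - ε) / ε * ((L : ℝ) / T * specNorm (Aw T A) ^ 2 * gammaW nx T σ δ) * (z ⬝ᵥ z) := by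
  have h := hLMI.re_dotProduct_nonneg (fun a => (z a : ℂ))
  set N : Matrix (Fin nx ⊕ Fin nu) (Fin nx ⊕ Fin nu) ℝ :=
    -(2 * (1 - ε) / ε) • GammaU L T B C ρ γe
        + (lam / T) • (1 : Matrix (Fin nx ⊕ Fin nu) (Fin nx ⊕ Fin nu) ℝ)
        - (2 * (1 - ε) / ε) • GammaW nu L T A σ δ
        - (1 / (T : ℝ) * (2 * C1 nx nu σ δ lam
            + 8 * σ ^ 2 * Real.log (Dbar lam (dataRegressor A B T freq ubar w)).det
            + 2 * lam * θbar ^ 2)) • Ddes with hN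
  have hstar : star (fun a => (z a : ℂ)) = fun a => (z a : ℂ) := by
    funext a; simp
  have hNq : ((fun a => (z a : ℂ)) ⬝ᵥ (N.map ((↑) : ℝ → ℂ) *ᵥ fun a => (z a : ℂ))).re =
      z ⬝ᵥ (N *ᵥ z) := by
    rw [← Complex.ofReal_re (z ⬝ᵥ (N *ᵥ z))]
    congr 1
    simp [Matrix.mulVec, dotProduct]
  have hV : ((fun a => (z a : ℂ)) ⬝ᵥ ((Vtr A B freq *
      (Ue ubar * Utildeᵀ + Utilde * (Ue ubar)ᵀ - Utilde * Utildeᵀ).map ((↑) : ℝ → ℂ) *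
        (Vtr A B freq)ᴴ) *ᵥ fun a => (z a : ℂ))).re ≤
      ∑ i, Complex.normSq (∑ a, (z a : ℂ) * response A B (freq i) (ubar i) a) := by
    -- Completing the square shows that the linearization at `Ũ` lies below `U_e U_eᵀ`; this is why
    -- `Ũ` may be arbitrary.
    have hQ : Ue ubar * Utildeᵀ + Utilde * (Ue ubar)ᵀ - Utilde * Utildeᵀ =
        Ue ubar * (Ue ubar)ᵀ - (Ue ubar - Utilde) * (Ue ubar - Utilde)ᵀ := by
      rw [Matrix.transpose_sub, Matrix.sub_mul, Matrix.mul_sub, Matrix.mul_sub]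
      abel
    rw [hQ, Matrix.map_sub _ Complex.ofReal_sub, Matrix.mul_sub, Matrix.sub_mul,
      Matrix.sub_mulVec, dotProduct_sub, Complex.sub_re, quadratic_conj_gram _ _ hstar,
      quadratic_conj_gram _ _ hstar]
    simp_rw [vecMul_Vtr_mul_Ue]
    exact sub_le_self _ (Finset.sum_nonneg fun j _ => Complex.normSq_nonneg _)
  simp only [lmiMatrix, hstar] at h
  rw [Matrix.add_mulVec, dotProduct_add, Matrix.smul_mulVec, dotProduct_smul] at h
  have h2 : (1 - ε : ℂ) = ((1 - ε : ℝ) : ℂ) := by push_cast; rfl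
  rw [h2, smul_eq_mul] at h
  simp only [RCLike.re_eq_complex_re, Complex.add_re, Complex.re_ofReal_mul] at h
  rw [hNq] at h
  have h3 := mul_le_mul_of_nonneg_left hV (by linarith : 0 ≤ 1 - ε)
  have h4 : z ⬝ᵥ (N *ᵥ z) =
      - (2 * (1 - ε) / ε * (4 * L * γe ^ 2 / T * (specNorm B * C / (1 - ρ) ^ 2) ^ 2) * (z ⬝ᵥ z))
      + lam / T * (z ⬝ᵥ z)
      - 2 * (1 - ε) / ε * ((L : ℝ) / T * specNorm (Aw T A) ^ 2 * gammaW nx T σ δ) * (z ⬝ᵥ z)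
      - 1 / (T : ℝ) * (2 * C1 nx nu σ δ lam
        + 8 * σ ^ 2 * Real.log (Dbar lam (dataRegressor A B T freq ubar w)).det
        + 2 * lam * θbar ^ 2) * (z ⬝ᵥ (Ddes *ᵥ z)) := by
    simp only [hN, GammaU, GammaW, Matrix.sub_mulVec, Matrix.add_mulVec, Matrix.smul_mulVec,
      Matrix.one_mulVec, dotProduct_add, dotProduct_sub, dotProduct_smul, smul_eq_mul]
    ring
  linarith

end Excitation

/-! ### Prior bound on the parameter -/

section Estimate

variable {nx nu : ℕ}

/-- Tensoring with the identity splits the form over the rows of the parameter matrix, so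
inequalities between forms of size `nx + nu` lift to the whole parameter vector. -/
theorem kronecker_one_quadratic (D : Matrix (Fin nx ⊕ Fin nu) (Fin nx ⊕ Fin nu) ℝ)
    (e : (Fin nx ⊕ Fin nu) × Fin nx → ℝ) :
    e ⬝ᵥ ((D ⊗ₖ (1 : Matrix (Fin nx) (Fin nx) ℝ)) *ᵥ e) =
      ∑ i, (fun a => e (a, i)) ⬝ᵥ (D *ᵥ fun a => e (a, i)) := by
  simp only [Matrix.mulVec, dotProduct, Fintype.sum_prod_type, Matrix.kroneckerMap_apply,
    Matrix.one_apply]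
  rw [Finset.sum_comm]
  simp

theorem dotProduct_self_eq_sum_rows (e : (Fin nx ⊕ Fin nu) × Fin nx → ℝ) :
    e ⬝ᵥ e = ∑ i, (fun a => e (a, i)) ⬝ᵥ fun a => e (a, i) := by
  simp only [dotProduct, Fintype.sum_prod_type]
  rw [Finset.sum_comm]

/-- Write `y = R(R⁻¹y)` with `R = D^(-1/2)`; then `|R⁻¹y|² = yᵀDy`. -/
theorem dotProduct_self_le_invSqrt {D : Matrix (Fin nx ⊕ Fin nu) (Fin nx ⊕ Fin nu) ℝ}
    (hD : D.PosDef) (y : Fin nx ⊕ Fin nu → ℝ) :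
    y ⬝ᵥ y ≤ specNorm (invSqrt D) ^ 2 * (y ⬝ᵥ (D *ᵥ y)) := by
  obtain ⟨ht, hsq, hdet⟩ := sqrt_spec hD.inv
  change (invSqrt D)ᵀ = invSqrt D at ht
  change invSqrt D * invSqrt D = D⁻¹ at hsq
  change (invSqrt D).det ≠ 0 at hdet
  set R := invSqrt D with hR
  have h1 : y = R *ᵥ (R⁻¹ *ᵥ y) := by
    rw [Matrix.mulVec_mulVec, Matrix.mul_nonsing_inv _ hdet.isUnit, Matrix.one_mulVec]
  have h2 := pow_le_pow_left₀ (euclNorm_nonneg _) (euclNorm_mulVec_le R (R⁻¹ *ᵥ y)) 2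
  rw [← h1, mul_pow, euclNorm_sq, euclNorm_sq] at h2
  have h3 : (R⁻¹ *ᵥ y) ⬝ᵥ (R⁻¹ *ᵥ y) = y ⬝ᵥ (D *ᵥ y) := by
    have hRi : (R⁻¹)ᵀ = R⁻¹ := by rw [Matrix.transpose_nonsing_inv, ht]
    have hDi : R⁻¹ * R⁻¹ = D := by
      rw [← Matrix.mul_inv_rev, hsq, Matrix.nonsing_inv_nonsing_inv _ hD.det_pos.ne'.isUnit]
    rw [← hDi, ← Matrix.mulVec_mulVec, Matrix.dotProduct_mulVec y R⁻¹, ← Matrix.mulVec_transpose,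
      hRi]
  rwa [h3] at h2

theorem dotProduct_self_le_thetaBar_sq {θhat0 θ : (Fin nx ⊕ Fin nu) × Fin nx → ℝ}
    {D0 : Matrix (Fin nx ⊕ Fin nu) (Fin nx ⊕ Fin nu) ℝ} (hD0 : D0.PosDef)
    (hprior : InEllipsoid D0 θhat0 θ) : θ ⬝ᵥ θ ≤ thetaBar θhat0 D0 ^ 2 := by
  have h1 : (θhat0 - θ) ⬝ᵥ (θhat0 - θ) ≤ specNorm (invSqrt D0) ^ 2 := by
    rw [dotProduct_self_eq_sum_rows]
    refine (Finset.sum_le_sum fun i _ => dotProduct_self_le_invSqrt hD0 _).trans ?_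
    rw [← Finset.mul_sum, ← kronecker_one_quadratic]
    exact mul_le_of_le_one_right (sq_nonneg _) hprior
  have h2 : euclNorm (θ - θhat0) ≤ specNorm (invSqrt D0) := by
    refine Real.sqrt_le_iff.2 ⟨specNorm_nonneg _, ?_⟩
    rwa [← neg_sub, neg_dotProduct, dotProduct_neg, neg_neg]
  have h3 := euclNorm_add_le θhat0 (θ - θhat0)
  rw [add_sub_cancel] at h3
  rw [← euclNorm_sq]
  exact pow_le_pow_left₀ (euclNorm_nonneg _) (h3.trans (add_le_add_right h2 _)) 2

/-! ### Error of the regularized least squares estimate -/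

theorem stackedState_eq (A : Matrix (Fin nx) (Fin nx) ℝ) (B : Matrix (Fin nx) (Fin nu) ℝ) (T : ℕ)
    (u : ℕ → Fin nu → ℝ) (w : ℕ → Fin nx → ℝ) :
    stackedState T (state A B u w) =
      (regressor T (state A B u w) u ⊗ₖ (1 : Matrix (Fin nx) (Fin nx) ℝ))ᵀ *ᵥ param A B
        + stackedNoise T w := by
  funext p
  rw [Pi.add_apply, transpose_kronecker_one_mulVec_apply]
  simp only [stackedState, state, stackedNoise, param, regressor, Matrix.of_apply, Matrix.vec,
    Fintype.sum_sum_type, Sum.elim_inl, Sum.elim_inr, Matrix.fromCols_apply_inl,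
    Matrix.fromCols_apply_inr, Pi.add_apply, Matrix.mulVec, dotProduct, mul_comm]

/-- The weighted error of the regularized least squares estimate splits into a bias part and a
noise part. -/
theorem quadratic_error_le {ι : Type*} [Fintype ι] [DecidableEq ι] {G : Matrix ι ι ℝ}
    (hG : G.PosSemidef) {lam : ℝ} (hlam : 0 < lam) {θ S e : ι → ℝ}
    (he : (G + lam • 1) *ᵥ e = lam • θ - S) :
    e ⬝ᵥ (G *ᵥ e) + lam / 2 * (e ⬝ᵥ e) ≤
      lam * (θ ⬝ᵥ θ) + 2 * (S ⬝ᵥ ((G + lam • 1)⁻¹ *ᵥ S)) := by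
  have hQ := posDef_add_smul_one hG hlam
  set Q := G + lam • (1 : Matrix ι ι ℝ) with hQd
  have hu := hQ.det_pos.ne'.isUnit
  have hGt : Gᵀ = G := by simpa using hG.isHermitian.eq
  set p := Q⁻¹ *ᵥ S with hp
  have hQp : Q *ᵥ p = S := by
    rw [hp, Matrix.mulVec_mulVec, Matrix.mul_nonsing_inv _ hu, Matrix.one_mulVec]
  set q := e + p with hq
  have hQq : Q *ᵥ q = lam • θ := by rw [hq, Matrix.mulVec_add, he, hQp, sub_add_cancel]
  have hQv : ∀ x y : ι → ℝ, x ⬝ᵥ (Q *ᵥ y) = x ⬝ᵥ (G *ᵥ y) + lam * (x ⬝ᵥ y) := by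
    intro x y
    rw [hQd, Matrix.add_mulVec, dotProduct_add, Matrix.smul_mulVec, Matrix.one_mulVec,
      dotProduct_smul, smul_eq_mul]
  have hpos : ∀ x : ι → ℝ, 0 ≤ x ⬝ᵥ (G *ᵥ x) := fun x => by
    simpa using hG.dotProduct_mulVec_nonneg x
  have h1 : S ⬝ᵥ p = p ⬝ᵥ (G *ᵥ p) + lam * (p ⬝ᵥ p) := by
    rw [dotProduct_comm, ← hQv, hQp]
  have h2 : lam * (q ⬝ᵥ θ) = q ⬝ᵥ (G *ᵥ q) + lam * (q ⬝ᵥ q) := by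
    rw [← hQv, hQq, dotProduct_smul, smul_eq_mul]
  -- With `D̄q = λθ` this square gives `2qᵀGq + λ|q|² ≤ λ|θ|²`. The squares of `q + p` give the
  -- parallelogram bounds for `e = q - p`, in the `G`-form and in the Euclidean norm.
  have h3 : 0 ≤ (q - θ) ⬝ᵥ (q - θ) := dotProduct_self_nonneg' _
  have h4 := hpos (q + p)
  have h5 : 0 ≤ (q + p) ⬝ᵥ (q + p) := dotProduct_self_nonneg' _
  have h6 : 0 ≤ p ⬝ᵥ p := dotProduct_self_nonneg' _
  have he' : e = q - p := by rw [hq, add_sub_cancel_right]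
  rw [he']
  simp only [sub_dotProduct, dotProduct_sub, add_dotProduct, dotProduct_add, Matrix.mulVec_add,
    Matrix.mulVec_sub, dotProduct_mulVec_comm_of_symm hGt p q, dotProduct_comm p q,
    dotProduct_comm θ q] at h3 h4 h5 ⊢
  nlinarith [mul_nonneg hlam.le h3, mul_nonneg hlam.le h5, mul_nonneg hlam.le h6]

theorem Dbar_mulVec_estimate_error {L : ℕ} (A : Matrix (Fin nx) (Fin nx) ℝ)
    (B : Matrix (Fin nx) (Fin nu) ℝ) (T : ℕ) {lam : ℝ} (hlam : 0 < lam) (freq : Fin L → ℝ)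
    (ubar : Fin L → Fin nu → ℝ) (w : ℕ → Fin nx → ℝ) :
    Dbar lam (dataRegressor A B T freq ubar w) *ᵥ
        (param A B - dataEstimate A B T lam freq ubar w) =
      lam • param A B - (dataRegressor A B T freq ubar w ⊗ₖ (1 : Matrix (Fin nx) (Fin nx) ℝ)) *ᵥ
        stackedNoise T w := by
  have hu := (posDef_Dbar hlam (dataRegressor A B T freq ubar w)).det_pos.ne'.isUnit
  rw [Matrix.mulVec_sub, dataEstimate, estimate, Matrix.mulVec_mulVec,
    Matrix.mul_nonsing_inv _ hu, Matrix.one_mulVec, stackedState_eq]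
  change _ - _ *ᵥ ((dataRegressor A B T freq ubar w ⊗ₖ _)ᵀ *ᵥ _ + _) = _
  rw [Matrix.mulVec_add, Matrix.mulVec_mulVec, ← gram_kronecker_one, Dbar, Matrix.add_mulVec,
    Matrix.smul_mulVec, Matrix.one_mulVec]
  abel

/-- The exploration goal on the event where the noise satisfies its tail bounds. -/
theorem goalHolds_of_LMIHolds {L T : ℕ} (hT : 0 < T) {A : Matrix (Fin nx) (Fin nx) ℝ}
    {B : Matrix (Fin nx) (Fin nu) ℝ} (hstable : SchurStable A)
    {C ρ : ℝ} (hC : 1 ≤ C) (hρ0 : 0 < ρ) (hρ1 : ρ < 1)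
    (hdecay : ∀ k : ℕ, specNorm (A ^ k) ≤ C * ρ ^ k)
    {θhat0 : (Fin nx ⊕ Fin nu) × Fin nx → ℝ}
    {D0 : Matrix (Fin nx ⊕ Fin nu) (Fin nx ⊕ Fin nu) ℝ} (hD0 : D0.PosDef)
    (hprior : InEllipsoid D0 θhat0 (param A B))
    {δ ε lam σ : ℝ} (hδ0 : 0 < δ) (hε0 : 0 < ε) (hε1 : ε < 1) (hlam : 0 < lam)
    {Ddes : Matrix (Fin nx ⊕ Fin nu) (Fin nx ⊕ Fin nu) ℝ}
    {freq : Fin L → ℝ} (hfreq : ∀ i, freq i ∈ freqGrid T) (hinj : Function.Injective freq)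
    {ubar : Fin L → Fin nu → ℝ} (hmirror : ∀ i j, freq i + freq j = 1 → ubar i = ubar j)
    {γe : ℝ} (hγe : 0 ≤ γe) (henergy : ∑ i, euclNorm (ubar i) ^ 2 ≤ γe ^ 2)
    {Utilde : Matrix (Fin L × Fin nu) (Fin L) ℝ} {w : ℕ → Fin nx → ℝ}
    {S : (Fin nx ⊕ Fin nu) × Fin nx → ℝ}
    (hS : S = (dataRegressor A B T freq ubar w ⊗ₖ (1 : Matrix (Fin nx) (Fin nx) ℝ)) *ᵥ
      stackedNoise T w)
    (hself : S ⬝ᵥ ((Dbar lam (dataRegressor A B T freq ubar w))⁻¹ *ᵥ S) ≤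
      σ ^ 2 * (Real.log (Dbar lam (dataRegressor A B T freq ubar w)).det
        - ((nx * (nx + nu) : ℕ) : ℝ) * Real.log lam + 2 * Real.log δ⁻¹))
    (hw : stackedNoise T w ⬝ᵥ stackedNoise T w ≤ 3 / 4 * gammaW nx T σ δ)
    (hLMI : LMIHolds A B T freq ubar Utilde C ρ γe σ δ ε lam (thetaBar θhat0 D0) Ddes w) :
    GoalHolds A B T lam freq ubar Ddes w := by
  have hT' : (0 : ℝ) < T := by exact_mod_cast hT
  set Phi := dataRegressor A B T freq ubar w with hPhi
  set e := param A B - dataEstimate A B T lam freq ubar w with he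
  set κ := 2 * C1 nx nu σ δ lam + 8 * σ ^ 2 * Real.log (Dbar lam Phi).det
    + 2 * lam * thetaBar θhat0 D0 ^ 2 with hκ
  set N := S ⬝ᵥ ((Dbar lam Phi)⁻¹ *ᵥ S) with hN
  have hGpsd := posSemidef_gram_kronecker_one Phi
  have herr := quadratic_error_le hGpsd hlam (θ := param A B) (S := S) (e := e)
    (by rw [hS]; exact Dbar_mulVec_estimate_error A B T hlam freq ubar w)
  change _ ≤ _ + 2 * N at herr
  have hθ := dotProduct_self_le_thetaBar_sq hD0 hprior
  have hN0 : 0 ≤ N := by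
    simpa using (posDef_Dbar hlam Phi).inv.posSemidef.dotProduct_mulVec_nonneg S
  -- The tail bound gives `8N ≤ 2C₁ + 8σ² log det D̄` up to the nonnegative `log 5` term, so half of
  -- that part of `κ` is spare.
  have hκN : 2 * lam * thetaBar θhat0 D0 ^ 2 + 4 * N ≤ κ := by
    have h5 : (0 : ℝ) ≤ (2 * nx : ℕ) * Real.log 5 := by
      have := Real.log_nonneg (show (1 : ℝ) ≤ 5 by norm_num)
      positivity
    have h6 : C1 nx nu σ δ lam = 4 * σ ^ 2 * ((2 * nx : ℕ) * Real.log 5 + 2 * Real.log δ⁻¹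
        - ((nx * (nx + nu) : ℕ) : ℝ) * Real.log lam) := by
      rw [C1, Real.log_div (by positivity) (by positivity), Real.log_pow, Real.log_pow,
        Real.log_inv]
      push_cast; ring
    have h7 := mul_nonneg (sq_nonneg σ) h5
    rw [hκ, h6]
    nlinarith
  -- `T` times the matrix inequality against twice the Gram bound: the excitation `T(1-ε)` is twice
  -- `T(1-ε)/2`, and the coefficients `2(1-ε)/ε` are twice those in `gram_ge`.
  have hrow : ∀ z : Fin nx ⊕ Fin nu → ℝ, κ * (z ⬝ᵥ (Ddes *ᵥ z)) ≤
      2 * (z ⬝ᵥ ((Phi * Phiᵀ) *ᵥ z)) + lam * (z ⬝ᵥ z) := by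
    intro z
    have h1 := lmi_quadratic hε1 hLMI z
    have h2 := gram_ge (B := B) hT hstable hC hρ0 hρ1 hdecay hfreq hinj hmirror hγe henergy hε0 hε1 hw z
    rw [← hκ] at h1
    have h3 := mul_le_mul_of_nonneg_left h1 hT'.le
    have h4 : T * (1 / (T : ℝ) * κ * (z ⬝ᵥ (Ddes *ᵥ z))) = κ * (z ⬝ᵥ (Ddes *ᵥ z)) := by
      field_simp
    rw [h4] at h3
    refine h3.trans (le_trans (le_of_eq ?_) (add_le_add_left
      (mul_le_mul_of_nonneg_left h2 zero_le_two) _))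
    field_simp
    ring
  have hsum : κ * (e ⬝ᵥ ((Ddes ⊗ₖ (1 : Matrix (Fin nx) (Fin nx) ℝ)) *ᵥ e)) ≤
      2 * (e ⬝ᵥ (((Phi * Phiᵀ) ⊗ₖ (1 : Matrix (Fin nx) (Fin nx) ℝ)) *ᵥ e)) + lam * (e ⬝ᵥ e) := by
    rw [kronecker_one_quadratic, kronecker_one_quadratic, dotProduct_self_eq_sum_rows,
      Finset.mul_sum, Finset.mul_sum, Finset.mul_sum, ← Finset.sum_add_distrib]
    exact Finset.sum_le_sum fun i _ => hrow _
  have hfin : κ * (e ⬝ᵥ ((Ddes ⊗ₖ (1 : Matrix (Fin nx) (Fin nx) ℝ)) *ᵥ e)) ≤ κ := by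
    have := mul_le_mul_of_nonneg_left hθ hlam.le
    linarith
  have hκ0 : 0 ≤ κ := by
    have : 0 ≤ 2 * lam * thetaBar θhat0 D0 ^ 2 := by positivity
    linarith
  change e ⬝ᵥ ((Ddes ⊗ₖ (1 : Matrix (Fin nx) (Fin nx) ℝ)) *ᵥ e) ≤ 1
  -- If `κ = 0`, dividing by it is impossible, but then the right-hand side of the error bound is 0
  -- and `e = 0`.
  rcases hκ0.eq_or_lt with h0 | h0
  · have h1 : lam / 2 * (e ⬝ᵥ e) ≤ 0 := by
      have h2 : 0 ≤ e ⬝ᵥ (((Phi * Phiᵀ) ⊗ₖ (1 : Matrix (Fin nx) (Fin nx) ℝ)) *ᵥ e) := by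
        simpa using hGpsd.dotProduct_mulVec_nonneg e
      have := mul_le_mul_of_nonneg_left hθ hlam.le
      linarith
    have h2 : e ⬝ᵥ e = 0 := le_antisymm
      (by by_contra h; exact absurd h1 (not_le.2 (mul_pos (half_pos hlam) (not_le.1 h))))
      (dotProduct_self_nonneg' e)
    rw [dotProduct_self_eq_zero.1 h2]
    simp
  · exact le_of_mul_le_mul_left (hfin.trans_eq (mul_one κ).symm) h0

end Estimate

end TargetedExploration

theorem proposition2
    {Ω : Type*} [mΩ : MeasurableSpace Ω] (P : Measure Ω) [IsProbabilityMeasure P]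
    {nx nu L T : ℕ} (hT : 0 < T)
    -- true system
    (A : Matrix (Fin nx) (Fin nx) ℝ) (B : Matrix (Fin nx) (Fin nu) ℝ)
    (hstable : SchurStable A) (hctrl : Controllable A B)
    (C ρ : ℝ) (hC : 1 ≤ C) (hρ0 : 0 < ρ) (hρ1 : ρ < 1)
    (hdecay : ∀ k : ℕ, specNorm (A ^ k) ≤ C * ρ ^ k)
    -- disturbance: `ℱ k` is the information available before `w k` is realized
    (ℱ : Filtration ℕ mΩ) (w : ℕ → Ω → Fin nx → ℝ)
    (hw : ∀ k, Measurable[ℱ (k + 1)] (w k))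
    (σ : ℝ) (hσ : 0 ≤ σ)
    (hsub : ∀ k, IsCondSubGaussian P (ℱ k) (w k) 0 (σ ^ 2 • 1))
    -- prior knowledge
    (θhat0 : (Fin nx ⊕ Fin nu) × Fin nx → ℝ)
    (D0 : Matrix (Fin nx ⊕ Fin nu) (Fin nx ⊕ Fin nu) ℝ) (hD0 : D0.PosDef)
    (hprior : InEllipsoid D0 θhat0 (param A B))
    -- design parameters
    (δ ε lam : ℝ) (hδ0 : 0 < δ) (hδ1 : δ < 1) (hε0 : 0 < ε) (hε1 : ε < 1) (hlam : 0 < lam)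
    (Ddes : Matrix (Fin nx ⊕ Fin nu) (Fin nx ⊕ Fin nu) ℝ) (hDdes : Ddes.PosDef)
    -- exploration input
    (freq : Fin L → ℝ) (hfreq : ∀ i, freq i ∈ freqGrid T) (hinj : Function.Injective freq)
    (ubar : Fin L → Fin nu → ℝ)
    (hmirror : ∀ i j, freq i + freq j = 1 → ubar i = ubar j)
    (γe : ℝ) (hγe : 0 ≤ γe) (henergy : ∑ i, euclNorm (ubar i) ^ 2 ≤ γe ^ 2)
    -- linearization point
    (Utilde : Matrix (Fin L × Fin nu) (Fin L) ℝ) :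
    -- with probability at least `1 - 2δ`, the inequality for the realized data implies the goal
    ENNReal.ofReal (1 - 2 * δ) ≤ P {s |
      LMIHolds A B T freq ubar Utilde C ρ γe σ δ ε lam (thetaBar θhat0 D0) Ddes
          (fun k => w k s) →
        GoalHolds A B T lam freq ubar Ddes (fun k => w k s)} ∧
    -- in particular, if the inequality holds almost surely, the goal has that probability
    ((∀ᵐ s ∂P, LMIHolds A B T freq ubar Utilde C ρ γe σ δ ε lam (thetaBar θhat0 D0) Ddes
          (fun k => w k s)) →
      ENNReal.ofReal (1 - 2 * δ) ≤ P {s |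
        GoalHolds A B T lam freq ubar Ddes (fun k => w k s)}) := by
  have hbad := measure_bad_noise_le (P := P) A B (exploreInput freq ubar) T ℱ hw hσ hsub hlam hδ0
    (Phi := fun s => dataRegressor A B T freq ubar fun k => w k s) (fun _ => rfl) (fun _ => rfl)
  have hmain : ENNReal.ofReal (1 - 2 * δ) ≤ P {s |
      LMIHolds A B T freq ubar Utilde C ρ γe σ δ ε lam (thetaBar θhat0 D0) Ddes
          (fun k => w k s) →
        GoalHolds A B T lam freq ubar Ddes (fun k => w k s)} := by
    -- The whole space is covered by the claimed event and the bad noise event, so subadditivity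
    -- suffices and neither set has to be measurable.
    rw [ENNReal.ofReal_sub _ (by positivity), ENNReal.ofReal_one, tsub_le_iff_right,
      ← measure_univ (μ := P)]
    refine le_trans (measure_mono fun s _ => ?_)
      ((measure_union_le _ _).trans (add_le_add le_rfl hbad))
    rw [Set.mem_union, or_iff_not_imp_right]
    intro hs
    simp only [Set.mem_ofPred_eq, not_not] at hs
    exact goalHolds_of_LMIHolds hT hstable hC hρ0 hρ1 hdecay hD0 hprior hδ0 hε0 hε1 hlam
      hfreq hinj hmirror hγe henergy rfl hs.1 hs.2
  refine ⟨hmain, fun hLMI => hmain.trans (measure_mono_ae ?_)⟩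
  filter_upwards [hLMI] with s hs h
  exact h hs
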